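/- Let $(\mathcal R,\mu)$ and $(\mathcal S,\nu)$ be non-atomic $\sigma$-finite measure spaces; $f^*(t)=\inf\{\lambda\ge 0:\mu(\{|f|>\lambda\})\le t\}$, $t>0$, denotes the non-increasing rearrangement. Let $1<p_0<q<\infty$, $1<p_1<\infty$, $1\le q_0<\infty$ and $r=\frac{p_0q}{p_1(q-p_0)}$. Lorentz spaces are given by $$\|f\|_{L^{a,b}}=\Big(\int_0^\infty t^{\frac ba-1}f^*(t)^b\,dt\Big)^{1/b}\ (b<\infty),\qquad \|f\|_{L^{a,\infty}}=\sup_{t>0}t^{1/a}f^*(t).$$ Let $X=X(\mathcal R,\mu)$ and $Y=Y(\mathcal S,\nu)$ be rearrangement-invariant Banach function spaces, with representation spaces $\bar X$ over $(0,\mu(\mathcal R))$ and $\bar Y$ over $(0,\nu(\mathcal S))$ (so that $\|f\|_X=\|f^*\|_{\bar X}$ and $\|g\|_Y=\|g^*\|_{\bar Y}$), and suppose that $X\subset (L^{p_0,q_0}+L^{q,1})(\mathcal R,\mu)$. Let $Y^{\langle p_1,\infty\rangle}(\mathcal S,\nu)$ be the set of measurable $g$ with $$\|g\|_{Y^{\langle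 p_1,\infty\rangle}}=\Big\|t^{-\frac1{p_1}}\sup_{0<s\le t}s^{\frac1{p_1}}g^*(s)\Big\|_{\bar Y(0,\nu(\mathcal S))}<\infty ,$$ and for nonnegative measurable $f$ on $(0,\mu(\mathcal R))$ and $t>0$ put $$R_{q_0}f(t)=t^{-\frac1{p_1}}\Big(\int_0^{t^r}s^{\frac{q_0}{p_0}-1}f^*(s)^{q_0}\,ds\Big)^{\frac1{q_0}},\qquad Sf(t)=\int_{t^r}^\infty s^{\frac1q-1}f^*(s)\,ds .$$ A map $T$ from $(L^{p_0,q_0}+L^{q,1})(\mathcal R,\mu)$ to the measurable functions on $(\mathcal S,\nu)$ is called quasilinear if there is $k\ge1$ such that $|T(f+g)|\le k(|Tf|+|Tg|)$ and $|T(af)|=|a|\,|Tf|$ $\nu$-a.e. for all $f,g$ in its domain and all $a\in\mathbb R$; it is called sublinear if this holds with $k=1$. Boundedness $T\colon A\to B$ means $\|Tf\|_B\le C\|f\|_A$ for all $f\in A$, with a finite constant $C$ independent of $f$. Then the following three statements are equivalent. (i) Every sublinear operator $T$ with $T\colon L^{p_0,q_0}(\mathcal R,\mu)\to L^{p_1,\infty}(\mathcal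 S,\nu)$ and $T\colon L^{q,1}(\mathcal R,\mu)\to L^\infty(\mathcal S,\nu)$ is bounded from $X(\mathcal R,\mu)$ to $Y^{\langle p_1,\infty\rangle}(\mathcal S,\nu)$. (ii) Every quasilinear operator $T$ with these two mapping properties is bounded from $X(\mathcal R,\mu)$ to $Y^{\langle p_1,\infty\rangle}(\mathcal S,\nu)$. (iii) The operators $R_{q_0}$ and $S$ are bounded from $\bar X(0,\mu(\mathcal R))$ to $\bar Y(0,\nu(\mathcal S))$. -/

import Mathlib

open MeasureTheory Set
open scoped ENNReal NNReal

noncomputable section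

namespace RI

/-- `μ` has no atoms: every measurable set of positive measure contains a measurable subset of
strictly smaller positive measure. -/
def Nonatomic {α : Type*} [MeasurableSpace α] (μ : Measure α) : Prop :=
  ∀ E : Set α, MeasurableSet E → 0 < μ E →
    ∃ F : Set α, MeasurableSet F ∧ F ⊆ E ∧ 0 < μ F ∧ μ F < μ E

/-- The non-increasing rearrangement `f^*(t) = inf {l ≥ 0 : μ {f > l} ≤ t}` of a nonnegative
function (used for `t > 0`). -/
def rearr {α : Type*} [MeasurableSpace α] (μ : Measure α) (f : α → ℝ≥0∞) (t : ℝ) : ℝ≥0∞ :=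
  sInf {l : ℝ≥0∞ | μ {x | l < f x} ≤ ENNReal.ofReal t}

/-- A rearrangement-invariant Banach function norm over `(α, μ)`. -/
structure RINorm {α : Type*} [MeasurableSpace α] (μ : Measure α) where
  /-- the functional; only its values at measurable functions matter -/
  toFun : (α → ℝ≥0∞) → ℝ≥0∞
  eq_zero_iff : ∀ f, Measurable f → (toFun f = 0 ↔ f =ᵐ[μ] 0)
  smul : ∀ (a : ℝ≥0) (f : α → ℝ≥0∞), Measurable f →
    toFun (fun x => (a : ℝ≥0∞) * f x) = a * toFun f
  add_le : ∀ f g, Measurable f → Measurable g →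
    toFun (fun x => f x + g x) ≤ toFun f + toFun g
  mono : ∀ f g, Measurable f → Measurable g → f ≤ᵐ[μ] g → toFun f ≤ toFun g
  fatou : ∀ (f : ℕ → α → ℝ≥0∞) (g : α → ℝ≥0∞), (∀ n, Measurable (f n)) → Measurable g →
    (∀ᵐ x ∂μ, Monotone (fun n => f n x)) → (∀ᵐ x ∂μ, ⨆ n, f n x = g x) →
    ⨆ n, toFun (f n) = toFun g
  indicator_lt_top : ∀ E : Set α, MeasurableSet E → μ E < ∞ → toFun (E.indicator 1) < ∞
  lintegral_le : ∀ E : Set α, MeasurableSet E → μ E < ∞ →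
    ∃ C : ℝ≥0, ∀ f, Measurable f → ∫⁻ x in E, f x ∂μ ≤ C * toFun f
  rearr_eq : ∀ f g, Measurable f → Measurable g →
    (∀ t : ℝ, 0 < t → rearr μ f t = rearr μ g t) → toFun f = toFun g

/-- Lebesgue measure on the interval `(0, μ(α))`, as a measure on `ℝ`. -/
def halfLine {α : Type*} [MeasurableSpace α] (μ : Measure α) : Measure ℝ :=
  volume.restrict {t : ℝ | 0 < t ∧ ENNReal.ofReal t < μ univ}

/-- The norm of the representation space of `ρ` on `(0, μ(α))`: the value at `h` is `ρ g` for any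
`g` over `(α, μ)` with `g^* = h^*`. By rearrangement invariance all such `g` give the same value,
and such a `g` exists when `μ` is nonatomic and `σ`-finite. -/
def RINorm.repr {α : Type*} [MeasurableSpace α] {μ : Measure α} (ρ : RINorm μ)
    (h : ℝ → ℝ≥0∞) : ℝ≥0∞ :=
  ⨅ (g : α → ℝ≥0∞) (_ : Measurable g)
    (_ : ∀ t : ℝ, 0 < t → rearr μ g t = rearr (halfLine μ) h t), ρ.toFun g

/-- The norm `‖f‖_X = ρ(|f|)` of the rearrangement-invariant space `X = X(ρ)`. -/
def RINorm.norm {α : Type*} [MeasurableSpace α] {μ : Measure α} (ρ : RINorm μ)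
    (f : α →ₘ[μ] ℝ) : ℝ≥0∞ :=
  ρ.toFun (fun x => ‖f x‖ₑ)

/-- The rearrangement of the absolute value of a real function. -/
def rearrAbs {α : Type*} [MeasurableSpace α] {μ : Measure α} (f : α →ₘ[μ] ℝ) : ℝ → ℝ≥0∞ :=
  rearr μ (fun x => ‖f x‖ₑ)

/-- The Lorentz functional of `L^{p,q}`, `q < ∞`. -/
def lorentz {α : Type*} [MeasurableSpace α] {μ : Measure α} (p q : ℝ) (f : α →ₘ[μ] ℝ) : ℝ≥0∞ :=
  (∫⁻ t in Ioi (0 : ℝ), ENNReal.ofReal (t ^ (q / p - 1)) * rearrAbs f t ^ q) ^ (1 / q)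

/-- The Lorentz functional of `L^{p,∞}`. -/
def weakLorentz {α : Type*} [MeasurableSpace α] {μ : Measure α} (p : ℝ) (f : α →ₘ[μ] ℝ) : ℝ≥0∞ :=
  ⨆ (t : ℝ) (_ : 0 < t), ENNReal.ofReal (t ^ (1 / p)) * rearrAbs f t

/-- The norm of `L^∞`. -/
def supNorm {α : Type*} [MeasurableSpace α] {μ : Measure α} (f : α →ₘ[μ] ℝ) : ℝ≥0∞ :=
  eLpNorm f ∞ μ

/-- The space `L^{p₀,q₀} + L^{q,1}`. -/
def lorentzSum {α : Type*} [MeasurableSpace α] (μ : Measure α) (p₀ q₀ q : ℝ) :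
    Set (α →ₘ[μ] ℝ) :=
  {f | ∃ f₀ f₁ : α →ₘ[μ] ℝ, lorentz p₀ q₀ f₀ < ∞ ∧ lorentz q 1 f₁ < ∞ ∧ f = f₀ + f₁}

/-- The functional of `Y^{⟨p,∞⟩}`:
`‖ t^{-1/p} sup_{0 < s ≤ t} s^{1/p} f^*(s) ‖` in the representation space of `Y`. -/
def RINorm.angleNorm {β : Type*} [MeasurableSpace β] {ν : Measure β} (ρ : RINorm ν) (p : ℝ)
    (f : β →ₘ[ν] ℝ) : ℝ≥0∞ :=
  ρ.repr (fun t => ENNReal.ofReal (t ^ (-(1 / p))) *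
    ⨆ (s : ℝ) (_ : 0 < s ∧ s ≤ t), ENNReal.ofReal (s ^ (1 / p)) * rearrAbs f s)

/-- The exponent `r = p₀ q / (p₁ (q - p₀))`. -/
def slope (p₀ p₁ q : ℝ) : ℝ := p₀ * q / (p₁ * (q - p₀))

/-- `R_{q₀} f(t) = t^{-1/p₁} (∫_0^{t^r} s^{q₀/p₀-1} f^*(s)^{q₀} ds)^{1/q₀}` for `f` on an interval
`(0, a)` with Lebesgue measure `m`; `f^*` vanishes on `[a, ∞)`. -/
def calderonR (m : Measure ℝ) (p₀ q₀ p₁ q : ℝ) (f : ℝ → ℝ≥0∞) (t : ℝ) : ℝ≥0∞ :=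
  ENNReal.ofReal (t ^ (-(1 / p₁))) *
    (∫⁻ s in Ioo (0 : ℝ) (t ^ slope p₀ p₁ q),
      ENNReal.ofReal (s ^ (q₀ / p₀ - 1)) * rearr m f s ^ q₀) ^ (1 / q₀)

/-- `S f(t) = ∫_{t^r}^∞ s^{1/q-1} f^*(s) ds`, with `f` and `m` as for `calderonR`. -/
def calderonS (m : Measure ℝ) (p₀ p₁ q : ℝ) (f : ℝ → ℝ≥0∞) (t : ℝ) : ℝ≥0∞ :=
  ∫⁻ s in Ioi (t ^ slope p₀ p₁ q), ENNReal.ofReal (s ^ (1 / q - 1)) * rearr m f s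

/-- `‖T f‖_B ≤ C ‖f‖_A` for all `f` with `‖f‖_A < ∞`, for some finite constant `C`. -/
def BoundedFrom {V W : Type*} (normA : V → ℝ≥0∞) (normB : W → ℝ≥0∞) (T : V → W) : Prop :=
  ∃ C : ℝ≥0, ∀ f : V, normA f < ∞ → normB (T f) ≤ C * normA f

/-- `T`, with domain `D` (its values outside `D` carry no meaning), satisfies
`|T(f+g)| ≤ k (|Tf| + |Tg|)` and `|T(af)| = |a| |Tf|` almost everywhere. -/
def QuasilinearWith {α β : Type*} [MeasurableSpace α] [MeasurableSpace β] {μ : Measure α}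
    {ν : Measure β} (k : ℝ) (D : Set (α →ₘ[μ] ℝ)) (T : (α →ₘ[μ] ℝ) → (β →ₘ[ν] ℝ)) : Prop :=
  (∀ f ∈ D, ∀ g ∈ D, ∀ᵐ y ∂ν, |T (f + g) y| ≤ k * (|T f y| + |T g y|)) ∧
  (∀ (a : ℝ), ∀ f ∈ D, ∀ᵐ y ∂ν, |T (a • f) y| = |a| * |T f y|)

/-- Quasilinear operators with domain `D`. -/
def Quasilinear {α β : Type*} [MeasurableSpace α] [MeasurableSpace β] {μ : Measure α}
    {ν : Measure β} (D : Set (α →ₘ[μ] ℝ)) (T : (α →ₘ[μ] ℝ) → (β →ₘ[ν] ℝ)) : Prop :=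
  ∃ k : ℝ, 1 ≤ k ∧ QuasilinearWith k D T

/-- Sublinear operators with domain `D`. -/
def Sublinear {α β : Type*} [MeasurableSpace α] [MeasurableSpace β] {μ : Measure α}
    {ν : Measure β} (D : Set (α →ₘ[μ] ℝ)) (T : (α →ₘ[μ] ℝ) → (β →ₘ[ν] ℝ)) : Prop :=
  QuasilinearWith 1 D T

/-- The endpoint estimates `T : L^{p₀,q₀} → L^{p₁,∞}` and `T : L^{q,1} → L^∞`. -/
def EndpointBounds {α β : Type*} [MeasurableSpace α] [MeasurableSpace β] {μ : Measure α}
    {ν : Measure β} (p₀ q₀ p₁ q : ℝ) (T : (α →ₘ[μ] ℝ) → (β →ₘ[ν] ℝ)) : Prop :=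
  BoundedFrom (lorentz p₀ q₀) (weakLorentz p₁) T ∧ BoundedFrom (lorentz q 1) supNorm T

/-- Boundedness of an operator on nonnegative functions between the representation spaces of
`ρX` and `ρY`. -/
def BoundedRepr {α β : Type*} [MeasurableSpace α] [MeasurableSpace β] {μ : Measure α}
    {ν : Measure β} (ρX : RINorm μ) (ρY : RINorm ν) (A : (ℝ → ℝ≥0∞) → (ℝ → ℝ≥0∞)) : Prop :=
  ∃ C : ℝ≥0, ∀ f : ℝ → ℝ≥0∞, Measurable f → ρX.repr f < ∞ → ρY.repr (A f) ≤ C * ρX.repr f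

end RI

end

/-! For (iii) ⇒ (ii), fix `f` and `t` and cut `f` at height `f^*(t^r)`. The excess over that height
has `L^{p₀,q₀}` norm at most `t^{1/p₁} R f^*(t)`, and the truncation has `L^{q,1}` norm at most `c R
f^*(t) + S f^*(t)`. The endpoint bounds for the two pieces, added by quasilinearity, control
`s^{1/p₁} (Tf)^*(s)` for every `s ≤ t` with this single cut, so the supremum in the norm of
`Y^{⟨p₁,∞⟩}` costs nothing. The resulting pointwise bound by `K (R f^* + S f^*)` is
`exists_angle_le`; taking norms in the representation space of `Y` finishes.

For (i) ⇒ (iii), `R` and `S` must be dominated by admissible sublinear operators, but `f ↦ f^*` is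
not subadditive. Take a measurable map `σ` from part of `α` that carries `μ` to Lebesgue measure on
`(0, μ(α))` (`exists_map_eq_halfLine`, from nonatomicity), and replace `f^*` by `Af(s) = s⁻¹ ∫_{σ <
s} |f|`. This is sublinear in `f`, is at most the mean of `f^*` over `(0, s)`, and is at least
`h(s)` when `f = h ∘ σ` with `h` a rearrangement. Hardy's inequality, available because `p₀ > 1` and
`q > 1`, shows that `R` and `S` applied to means satisfy both endpoint estimates
(`EndpointFunctional`). So `Tf = Φ(Af) ∘ σ'`, with `Φ` either functional and `σ'` the corresponding
map on `β`, is admissible in (i), and testing it on `h ∘ σ` gives (iii)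
(`boundedRepr_of_bounded_avgOperator`).

(ii) ⇒ (i) is the case `k = 1`. -/

noncomputable section

namespace RI

/-! ### Nonatomic measures: mapping onto an interval -/

section Chain

variable {α : Type*} [MeasurableSpace α] {μ : Measure α}

/-- A maximal chain of measurable sets of finite measure, ordered by strict growth of the
measure. -/
structure IsMeasureChain (μ : Measure α) (M : Set (Set α)) : Prop where
  meas : ∀ E ∈ M, MeasurableSet E
  fin : ∀ E ∈ M, μ E < ∞
  empty_mem : ∅ ∈ M
  subset_of_lt : ∀ E ∈ M, ∀ F ∈ M, μ E < μ F → E ⊆ F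
  eq_of_eq : ∀ E ∈ M, ∀ F ∈ M, μ E = μ F → E = F
  maximal : ∀ A, MeasurableSet A → μ A < ∞ →
    (∀ F ∈ M, F = A ∨ (F ⊆ A ∧ μ F < μ A) ∨ (A ⊆ F ∧ μ A < μ F)) → A ∈ M

theorem exists_isMeasureChain (μ : Measure α) : ∃ M, IsMeasureChain μ M := by
  let T := {E : Set α // MeasurableSet E ∧ μ E < ∞}
  let r : T → T → Prop := fun E F => E.1 ⊆ F.1 ∧ μ E.1 < μ F.1
  have h0 : IsChain r {(⟨∅, by simp⟩ : T)} := by simp [IsChain]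
  obtain ⟨M, hM, h0M⟩ := h0.exists_maxChain
  refine ⟨Subtype.val '' M, ⟨?_, ?_, ?_, ?_, ?_, ?_⟩⟩
  · rintro _ ⟨E, -, rfl⟩; exact E.2.1
  · rintro _ ⟨E, -, rfl⟩; exact E.2.2
  · exact ⟨_, h0M rfl, rfl⟩
  · rintro _ ⟨E, hE, rfl⟩ _ ⟨F, hF, rfl⟩ h
    have hne : E ≠ F := by rintro rfl; exact lt_irrefl _ h
    rcases hM.1 hE hF hne with h' | h'
    · exact h'.1
    · exact absurd h h'.2.not_gt
  · rintro _ ⟨E, hE, rfl⟩ _ ⟨F, hF, rfl⟩ h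
    by_contra hne
    rcases hM.1 hE hF (fun h => hne (by rw [h])) with h' | h'
    · exact h'.2.ne h
    · exact h'.2.ne h.symm
  · intro A hA hA' h
    let A' : T := ⟨A, hA, hA'⟩
    have hc : IsChain r (insert A' M) := by
      refine hM.1.insert fun F hF hne => ?_
      rcases h F.1 ⟨F, hF, rfl⟩ with h' | h' | h'
      · exact absurd (Subtype.ext h'.symm) hne
      · exact Or.inr h'
      · exact Or.inl h'
    have := hM.2 hc (subset_insert _ _)
    exact ⟨A', this ▸ mem_insert _ _, rfl⟩

namespace IsMeasureChain

variable {M : Set (Set α)}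

theorem subset_of_le (hM : IsMeasureChain μ M) {E F : Set α} (hE : E ∈ M) (hF : F ∈ M)
    (h : μ E ≤ μ F) : E ⊆ F := by
  rcases h.lt_or_eq with h | h
  · exact hM.subset_of_lt E hE F hF h
  · exact (hM.eq_of_eq E hE F hF h).subset

/-- Otherwise an increasing sequence in the chain exhausts all members of measure at most `t`. Its
union is comparable with every member, hence belongs to the chain by maximality, and is itself
greatest. -/
theorem exists_greatest (hM : IsMeasureChain μ M) {t : ℝ≥0∞} (ht : t ≠ ∞) :
    ∃ A ∈ M, μ A ≤ t ∧ ∀ E ∈ M, μ E ≤ t → μ E ≤ μ A := by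
  by_contra! hcon
  let L := {E | E ∈ M ∧ μ E ≤ t}
  have hne : (μ '' L).Nonempty := ⟨_, ∅, ⟨hM.empty_mem, by simp⟩, rfl⟩
  obtain ⟨u, humono, hulim, hu⟩ := exists_seq_tendsto_sSup hne (OrderTop.bddAbove _)
  choose E hE hEu using hu
  have hdom : ∀ F ∈ L, ∃ n, μ F < μ (E n) := by
    intro F hF
    obtain ⟨G, hG, hGt, hFG⟩ := hcon F hF.1 hF.2
    have : μ F < sSup (μ '' L) := hFG.trans_le (le_sSup ⟨G, ⟨hG, hGt⟩, rfl⟩)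
    obtain ⟨n, hn⟩ := (hulim.eventually (lt_mem_nhds this)).exists
    exact ⟨n, by rwa [hEu]⟩
  have hmono : Monotone E := fun m n hmn =>
    hM.subset_of_le (hE m).1 (hE n).1 (by rw [hEu, hEu]; exact humono hmn)
  have hA : μ (⋃ n, E n) ≤ t := by
    rw [hmono.measure_iUnion]; exact iSup_le fun n => (hE n).2
  have hAm : (⋃ n, E n) ∈ M := by
    refine hM.maximal _ (.iUnion fun n => hM.meas _ (hE n).1) (hA.trans_lt ht.lt_top)
      fun F hF => Or.inr ?_
    by_cases hFt : μ F ≤ t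
    · obtain ⟨n, hn⟩ := hdom F ⟨hF, hFt⟩
      exact Or.inl ⟨(hM.subset_of_lt _ hF _ (hE n).1 hn).trans (subset_iUnion _ _),
        hn.trans_le (measure_mono (subset_iUnion _ _))⟩
    · refine Or.inr ⟨iUnion_subset fun n => hM.subset_of_lt _ (hE n).1 _ hF
        ((hE n).2.trans_lt (not_le.1 hFt)), hA.trans_lt (not_le.1 hFt)⟩
  obtain ⟨n, hn⟩ := hdom _ ⟨hAm, hA⟩
  exact absurd hn (measure_mono (subset_iUnion _ _)).not_gt

/-- Dual to `exists_greatest`, with an intersection; continuity from above applies because members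
have finite measure. -/
theorem exists_least (hM : IsMeasureChain μ M) {t : ℝ≥0∞} (ht : ∃ E ∈ M, t ≤ μ E) :
    ∃ A ∈ M, t ≤ μ A ∧ ∀ E ∈ M, t ≤ μ E → μ A ≤ μ E := by
  by_contra! hcon
  let L := {E | E ∈ M ∧ t ≤ μ E}
  have hne : (μ '' L).Nonempty := by
    obtain ⟨E, hE⟩ := ht
    exact ⟨_, E, hE, rfl⟩
  obtain ⟨u, humono, hulim, hu⟩ := exists_seq_tendsto_sInf hne (OrderBot.bddBelow _)
  choose E hE hEu using hu
  have hdom : ∀ F ∈ L, ∃ n, μ (E n) < μ F := by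
    intro F hF
    obtain ⟨G, hG, hGt, hFG⟩ := hcon F hF.1 hF.2
    have : sInf (μ '' L) < μ F :=
      (sInf_le (show μ G ∈ μ '' L from ⟨G, ⟨hG, hGt⟩, rfl⟩)).trans_lt hFG
    obtain ⟨n, hn⟩ := (hulim.eventually (gt_mem_nhds this)).exists
    exact ⟨n, by rwa [hEu]⟩
  have hmono : Antitone E := fun m n hmn =>
    hM.subset_of_le (hE n).1 (hE m).1 (by rw [hEu, hEu]; exact humono hmn)
  have hA : t ≤ μ (⋂ n, E n) := by
    rw [hmono.measure_iInter (fun n => (hM.meas _ (hE n).1).nullMeasurableSet)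
      ⟨0, (hM.fin _ (hE 0).1).ne⟩]
    exact le_iInf fun n => (hE n).2
  have hAm : (⋂ n, E n) ∈ M := by
    refine hM.maximal _ (.iInter fun n => hM.meas _ (hE n).1)
      ((measure_mono (iInter_subset _ 0)).trans_lt (hM.fin _ (hE 0).1)) fun F hF => Or.inr ?_
    by_cases hFt : t ≤ μ F
    · obtain ⟨n, hn⟩ := hdom F ⟨hF, hFt⟩
      exact Or.inr ⟨(iInter_subset _ _).trans (hM.subset_of_lt _ (hE n).1 _ hF hn),
        (measure_mono (iInter_subset _ _)).trans_lt hn⟩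
    · refine Or.inl ⟨subset_iInter fun n => hM.subset_of_lt _ hF _ (hE n).1
        ((not_le.1 hFt).trans_le (hE n).2), (not_le.1 hFt).trans_le hA⟩
  obtain ⟨n, hn⟩ := hdom _ ⟨hAm, hA⟩
  exact absurd hn (measure_mono (iInter_subset _ _)).not_gt

/-- A maximal chain skips no value. A gap between consecutive members `A ⊆ B` could be refined by a
piece of `B \ A`, by nonatomicity; a chain ending below `t` could be prolonged by a piece of `Aᶜ` of
finite positive measure, by σ-finiteness. -/
theorem exists_measure_eq [SigmaFinite μ] (hμ : Nonatomic μ) (hM : IsMeasureChain μ M)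
    {t : ℝ≥0∞} (ht : t < μ univ) : ∃ E ∈ M, μ E = t := by
  obtain ⟨A, hA, hAt, hAmax⟩ := hM.exists_greatest ht.ne_top
  rcases hAt.eq_or_lt with h | hAt
  · exact ⟨A, hA, h⟩
  by_cases hU : ∃ E ∈ M, t ≤ μ E
  · obtain ⟨B, hB, htB, hBmin⟩ := hM.exists_least hU
    rcases htB.eq_or_lt with h | htB
    · exact ⟨B, hB, h.symm⟩
    exfalso
    have hAB := hM.subset_of_le hA hB (hAt.trans htB).le
    have hd : μ (B \ A) = μ B - μ A :=
      measure_sdiff hAB (hM.meas A hA).nullMeasurableSet (hM.fin A hA).ne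
    obtain ⟨F, hF, hFs, hF0, hF1⟩ := hμ (B \ A) ((hM.meas B hB).diff (hM.meas A hA))
      (by rw [hd]; exact tsub_pos_of_lt (hAt.trans htB))
    have hdisj : Disjoint A F := disjoint_left.2 fun x hx hx' => (hFs hx').2 hx
    have hAF : μ (A ∪ F) = μ A + μ F := measure_union hdisj hF
    have h1 : μ A < μ (A ∪ F) := by
      rw [hAF]; exact ENNReal.lt_add_right (hM.fin A hA).ne hF0.ne'
    have h2 : μ (A ∪ F) < μ B := by
      rw [hAF, add_comm]; rw [hd] at hF1; exact lt_tsub_iff_right.1 hF1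
    have h3 : A ∪ F ⊆ B := union_subset hAB (hFs.trans sdiff_subset)
    have hmem : A ∪ F ∈ M := by
      refine hM.maximal _ ((hM.meas A hA).union hF) (h2.trans (hM.fin B hB)) fun G hG => Or.inr ?_
      rcases le_total (μ G) t with h | h
      · have := hAmax G hG h
        exact Or.inl ⟨(hM.subset_of_le hG hA this).trans subset_union_left, this.trans_lt h1⟩
      · have := hBmin G hG h
        exact Or.inr ⟨h3.trans (hM.subset_of_le hB hG this), h2.trans_le this⟩
    rcases le_total (μ (A ∪ F)) t with h | h
    · exact absurd h1 (hAmax _ hmem h).not_gt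
    · exact absurd h2 (hBmin _ hmem h).not_gt
  · exfalso
    push Not at hU
    have hc : 0 < μ Aᶜ := by
      rw [pos_iff_ne_zero]
      intro h
      have : μ univ ≤ μ A + μ Aᶜ := by rw [← union_compl_self A]; exact measure_union_le _ _
      rw [h, add_zero] at this
      exact absurd (ht.trans_le this) hAt.not_gt
    obtain ⟨F, hFs, hF, hF0, hF1⟩ : ∃ F ⊆ Aᶜ, MeasurableSet F ∧ 0 < μ F ∧ μ F < ∞ := by
      obtain ⟨n, hn⟩ : ∃ n, 0 < μ (Aᶜ ∩ spanningSets μ n) := by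
        by_contra! h
        have : μ (⋃ n, Aᶜ ∩ spanningSets μ n) = 0 :=
          measure_iUnion_null fun n => nonpos_iff_eq_zero.1 (h n)
        rw [← inter_iUnion, iUnion_spanningSets, inter_univ] at this
        exact hc.ne' this
      exact ⟨_, inter_subset_left, (hM.meas A hA).compl.inter (measurableSet_spanningSets μ n), hn,
        (measure_mono inter_subset_right).trans_lt (measure_spanningSets_lt_top μ n)⟩
    have hdisj : Disjoint A F := disjoint_left.2 fun x hx hx' => hFs hx' hx
    have hAF : μ (A ∪ F) = μ A + μ F := measure_union hdisj hF
    have h1 : μ A < μ (A ∪ F) := by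
      rw [hAF]; exact ENNReal.lt_add_right (hM.fin A hA).ne hF0.ne'
    have hmem : A ∪ F ∈ M := by
      refine hM.maximal _ ((hM.meas A hA).union hF)
        (by rw [hAF]; exact ENNReal.add_lt_top.2 ⟨hM.fin A hA, hF1⟩) fun G hG => Or.inr ?_
      have := hAmax G hG (hU G hG).le
      exact Or.inl ⟨(hM.subset_of_le hG hA this).trans subset_union_left, this.trans_lt h1⟩
    exact absurd h1 (hAmax _ hmem (hU _ hmem).le).not_gt

end IsMeasureChain

/-- The interval `(0, μ(α))`. -/
def lengthInterval (μ : Measure α) : Set ℝ := {t : ℝ | 0 < t ∧ ENNReal.ofReal t < μ univ}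

theorem halfLine_eq (μ : Measure α) : halfLine μ = volume.restrict (lengthInterval μ) := rfl

theorem halfLine_Iio (μ : Measure α) (t : ℝ) :
    halfLine μ (Iio t) = min (ENNReal.ofReal t) (μ univ) := by
  rw [halfLine_eq, Measure.restrict_apply measurableSet_Iio]
  rcases le_or_gt (ENNReal.ofReal t) (μ univ) with h | h
  · have : Iio t ∩ lengthInterval μ = Ioo 0 t := by
      ext s
      simp only [lengthInterval, mem_inter_iff, mem_Iio, mem_ofPred_eq, mem_Ioo]
      constructor
      · rintro ⟨h1, h2, -⟩; exact ⟨h2, h1⟩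
      · rintro ⟨h1, h2⟩
        exact ⟨h2, h1, ((ENNReal.ofReal_lt_ofReal_iff (h1.trans h2)).2 h2).trans_le h⟩
    rw [this, Real.volume_Ioo, sub_zero, min_eq_left h]
  · have hne : μ univ ≠ ∞ := h.ne_top
    have : Iio t ∩ lengthInterval μ = Ioo 0 (μ univ).toReal := by
      ext s
      simp only [lengthInterval, mem_inter_iff, mem_Iio, mem_ofPred_eq, mem_Ioo]
      constructor
      · rintro ⟨-, h2, h3⟩; exact ⟨h2, (ENNReal.ofReal_lt_iff_lt_toReal h2.le hne).1 h3⟩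
      · rintro ⟨h2, h3⟩
        have h4 := (ENNReal.ofReal_lt_iff_lt_toReal h2.le hne).2 h3
        exact ⟨(ENNReal.ofReal_lt_ofReal_iff_of_nonneg h2.le).1 (h4.trans h), h2, h4⟩
    rw [this, Real.volume_Ioo, sub_zero, min_eq_right h.le, ENNReal.ofReal_toReal hne]

/-- The map is `σ x = inf {q : x ∈ E q}`, where the `E q` are nested sets of measure `q` for
rational `q`; then `{σ < t}` has the measure of `(0, t)`. The set `A` is needed because, when `μ` is
infinite, the `E q` may leave out a set of positive measure. -/
theorem exists_map_eq_halfLine [SigmaFinite μ] (hμ : Nonatomic μ) :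
    ∃ (A : Set α) (σ : α → ℝ), MeasurableSet A ∧ Measurable σ ∧
      (μ.restrict A).map σ = halfLine μ := by
  obtain ⟨M, hM⟩ := exists_isMeasureChain μ
  have hex : ∀ q : ℚ, ∃ E : Set α, E ∈ M ∧ ((q : ℝ) ∈ lengthInterval μ →
      μ E = ENNReal.ofReal q) := by
    intro q
    by_cases hq : (q : ℝ) ∈ lengthInterval μ
    · obtain ⟨E, hE, h⟩ := hM.exists_measure_eq hμ hq.2
      exact ⟨E, hE, fun _ => h⟩
    · exact ⟨∅, hM.empty_mem, fun h => absurd h hq⟩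
  choose E hEM hEq using hex
  let I : Set ℚ := {q | (q : ℝ) ∈ lengthInterval μ}
  let A : Set α := ⋃ q ∈ I, E q
  let V : α → Set ℝ := fun x => {s | ∃ q ∈ I, x ∈ E q ∧ s = q}
  let σ : α → ℝ := fun x => sInf (V x)
  have hVb : ∀ x, BddBelow (V x) := by
    intro x
    refine ⟨0, ?_⟩
    rintro _ ⟨q, hq, -, rfl⟩
    exact hq.1.le
  have hEmeas : ∀ q, MeasurableSet (E q) := fun q => hM.meas _ (hEM q)
  have hA : MeasurableSet A := .biUnion (to_countable _) fun q _ => hEmeas q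
  have hlt : ∀ t : ℝ, A ∩ σ ⁻¹' Iio t = ⋃ q ∈ {q ∈ I | (q : ℝ) < t}, E q := by
    intro t
    ext x
    simp only [mem_inter_iff, mem_preimage, mem_Iio, mem_iUnion, exists_prop, mem_ofPred_eq, A]
    constructor
    · rintro ⟨⟨q, hq, hxq⟩, h⟩
      obtain ⟨_, ⟨q', hq', hx', rfl⟩, h'⟩ :=
        exists_lt_of_csInf_lt (show (V x).Nonempty from ⟨_, q, hq, hxq, rfl⟩) h
      exact ⟨q', ⟨hq', h'⟩, hx'⟩
    · rintro ⟨q, ⟨hq, hqt⟩, hx⟩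
      exact ⟨⟨q, hq, hx⟩, (csInf_le (hVb x) ⟨q, hq, hx, rfl⟩).trans_lt hqt⟩
  -- Here the infimum is over the empty set, with default value `0`. Only measurability of `σ`
  -- depends on it.
  have hout : ∀ x ∉ A, σ x = 0 := by
    intro x hx
    have : V x = ∅ := by
      rw [eq_empty_iff_forall_notMem]
      rintro _ ⟨q, hq, hxq, -⟩
      exact hx (mem_biUnion hq hxq)
    simp only [σ, this, Real.sInf_empty]
  have hltm : ∀ t : ℝ, MeasurableSet (A ∩ σ ⁻¹' Iio t) := by
    intro t
    rw [hlt]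
    exact .biUnion (to_countable _) fun q _ => hEmeas q
  have hσ : Measurable σ := by
    refine measurable_of_Iio fun t => ?_
    have : σ ⁻¹' Iio t = (A ∩ σ ⁻¹' Iio t) ∪ (Aᶜ ∩ {_x | 0 < t}) := by
      ext x
      by_cases hx : x ∈ A
      · simp [hx]
      · simp [hx, hout x hx]
    rw [this]
    exact (hltm t).union (hA.compl.inter (MeasurableSet.const _))
  have hmeas : ∀ t : ℝ, (μ.restrict A).map σ (Iio t) = min (ENNReal.ofReal t) (μ univ) := by
    intro t
    rw [Measure.map_apply hσ measurableSet_Iio,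
      Measure.restrict_apply (hσ measurableSet_Iio), inter_comm, hlt t]
    -- The `E q` are nested, so the measure of their countable union is the supremum of their
    -- measures.
    have hdir : DirectedOn (Function.onFun (· ⊆ ·) E) {q ∈ I | (q : ℝ) < t} := by
      rintro q ⟨hq, hqt⟩ q' ⟨hq', hqt'⟩
      rcases le_total (μ (E q)) (μ (E q')) with h | h
      · exact ⟨q', ⟨hq', hqt'⟩, hM.subset_of_le (hEM q) (hEM q') h, Subset.rfl⟩
      · exact ⟨q, ⟨hq, hqt⟩, Subset.rfl, hM.subset_of_le (hEM q') (hEM q) h⟩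
    rw [measure_biUnion_eq_iSup (to_countable _) hdir]
    apply le_antisymm
    · refine iSup₂_le fun q hq => ?_
      rw [hEq q hq.1]
      exact le_min (ENNReal.ofReal_le_ofReal hq.2.le) hq.1.2.le
    · refine le_of_forall_lt fun c hc => ?_
      have hct : c < ENNReal.ofReal t := hc.trans_le (min_le_left _ _)
      have hcu : c < μ univ := hc.trans_le (min_le_right _ _)
      obtain ⟨q, hq0, hcq, hq⟩ := ENNReal.lt_iff_exists_rat_btwn.1 hc
      have hq' : c < ENNReal.ofReal q := hcq
      have hqpos : (0 : ℝ) < q := by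
        by_contra! h
        rw [ENNReal.ofReal_of_nonpos h] at hq'
        exact not_lt_zero hq'
      have h1 : ENNReal.ofReal q < ENNReal.ofReal t := lt_of_lt_of_le hq (min_le_left _ _)
      have h2 : ENNReal.ofReal q < μ univ := lt_of_lt_of_le hq (min_le_right _ _)
      have hqI : q ∈ {q ∈ I | (q : ℝ) < t} :=
        ⟨⟨hqpos, h2⟩, (ENNReal.ofReal_lt_ofReal_iff_of_nonneg hqpos.le).1 h1⟩
      refine hq'.trans_le ?_
      rw [← hEq q hqI.1]
      exact le_iSup₂ (f := fun q _ => μ (E q)) q hqI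
  refine ⟨A, σ, hA, hσ, ?_⟩
  refine Measure.ext_of_generateFrom_of_iUnion (⋃ a : ℚ, {Iio (a : ℝ)}) (fun n : ℕ => Iio (n : ℝ))
    ?_ Real.isPiSystem_Iio_rat ?_ ?_ ?_ ?_
  · rw [← Real.borel_eq_generateFrom_Iio_rat]; exact BorelSpace.measurable_eq
  · exact iUnion_eq_univ_iff.2 fun x => exists_nat_gt x
  · intro n; exact mem_iUnion.2 ⟨n, by simp⟩
  · intro n
    rw [hmeas]; exact ((min_le_left _ _).trans_lt ENNReal.ofReal_lt_top).ne
  · intro s hs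
    obtain ⟨q, rfl⟩ := mem_iUnion.1 hs
    rw [hmeas, halfLine_Iio]

end Chain

/-! ### Rearrangements and equimeasurability -/

section Rearrangement

variable {α : Type*} [MeasurableSpace α] {μ : Measure α}

/-- The infimum defining `rearr` is attained, by continuity from below along levels decreasing to
`l`. This gives the equivalence `lt_rearr_iff`, through which rearrangements are handled from here
on. -/
theorem measure_lt_le_of_rearr_le {f : α → ℝ≥0∞} {t : ℝ} {l : ℝ≥0∞} (h : rearr μ f t ≤ l) :
    μ {x | l < f x} ≤ ENNReal.ofReal t := by
  rcases eq_or_ne l ∞ with rfl | hl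
  · simp
  obtain ⟨u, hu, hul, hulim⟩ := exists_seq_strictAnti_tendsto' hl.lt_top
  have hU : {x | l < f x} = ⋃ n, {x | u n < f x} := by
    ext x
    simp only [mem_ofPred_eq, mem_iUnion]
    constructor
    · intro hx
      exact (hulim.eventually (gt_mem_nhds hx)).exists
    · rintro ⟨n, hn⟩
      exact (hul n).1.trans hn
  have hmono : Monotone fun n => {x | u n < f x} := fun m n hmn x hx =>
    lt_of_le_of_lt (hu.antitone hmn) hx
  rw [hU, hmono.measure_iUnion]
  refine iSup_le fun n => ?_
  obtain ⟨m, hm, hmn⟩ := sInf_lt_iff.1 (h.trans_lt (hul n).1)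
  exact (measure_mono fun x hx => hmn.trans hx).trans hm

theorem lt_rearr_iff {f : α → ℝ≥0∞} {t : ℝ} {l : ℝ≥0∞} :
    l < rearr μ f t ↔ ENNReal.ofReal t < μ {x | l < f x} := by
  rw [← not_iff_not, not_lt, not_lt]
  exact ⟨measure_lt_le_of_rearr_le, fun h => sInf_le h⟩

theorem rearr_le_iff {f : α → ℝ≥0∞} {t : ℝ} {l : ℝ≥0∞} :
    rearr μ f t ≤ l ↔ μ {x | l < f x} ≤ ENNReal.ofReal t := by
  rw [← not_lt, lt_rearr_iff, not_lt]

theorem rearr_antitone (f : α → ℝ≥0∞) : Antitone (rearr μ f) := fun _ _ hst =>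
  rearr_le_iff.2 ((measure_lt_le_of_rearr_le le_rfl).trans (ENNReal.ofReal_le_ofReal hst))

theorem measurable_rearr (f : α → ℝ≥0∞) : Measurable (rearr μ f) := (rearr_antitone f).measurable

theorem rearr_mono_ae {f g : α → ℝ≥0∞} (h : f ≤ᵐ[μ] g) (t : ℝ) : rearr μ f t ≤ rearr μ g t :=
  rearr_le_iff.2 ((measure_mono_ae (h.mono fun _ hx hl => lt_of_lt_of_le hl hx)).trans
    (measure_lt_le_of_rearr_le le_rfl))

theorem rearr_congr_ae {f g : α → ℝ≥0∞} (h : f =ᵐ[μ] g) (t : ℝ) : rearr μ f t = rearr μ g t :=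
  le_antisymm (rearr_mono_ae h.le t) (rearr_mono_ae h.symm.le t)

theorem rearr_congr_measure {β : Type*} [MeasurableSpace β] {ν : Measure β} {f : α → ℝ≥0∞}
    {g : β → ℝ≥0∞} (h : ∀ l, μ {x | l < f x} = ν {y | l < g y}) (t : ℝ) :
    rearr μ f t = rearr ν g t := by
  simp only [rearr, h]

theorem volume_pos_ofReal_lt (d : ℝ≥0∞) : volume {v : ℝ | 0 < v ∧ ENNReal.ofReal v < d} = d := by
  rcases eq_or_ne d ∞ with rfl | hd
  · have : {v : ℝ | 0 < v ∧ ENNReal.ofReal v < ∞} = Ioi 0 := by ext; simp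
    rw [this, Real.volume_Ioi]
  · have : {v : ℝ | 0 < v ∧ ENNReal.ofReal v < d} = Ioo 0 d.toReal := by
      ext v
      simp only [mem_ofPred_eq, mem_Ioo]
      exact and_congr_right fun h => ENNReal.ofReal_lt_iff_lt_toReal h.le hd
    rw [this, Real.volume_Ioo, sub_zero, ENNReal.ofReal_toReal hd]

theorem halfLine_univ (μ : Measure α) : halfLine μ univ = μ univ := by
  rw [halfLine, Measure.restrict_apply_univ, volume_pos_ofReal_lt]

theorem halfLine_halfLine (μ : Measure α) : halfLine (halfLine μ) = halfLine μ := by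
  rw [halfLine, halfLine_univ, halfLine]

/-- The set `{f^* > l}` in `(0, μ(α))` is an initial interval of length `μ {f > l}`, so `f^*` and
`f` are equimeasurable. -/
theorem rearr_rearr (f : α → ℝ≥0∞) (t : ℝ) :
    rearr (halfLine μ) (rearr μ f) t = rearr μ f t := by
  refine rearr_congr_measure (fun l => ?_) t
  simp only [lt_rearr_iff]
  rw [halfLine, Measure.restrict_apply
    (measurableSet_lt ENNReal.measurable_ofReal measurable_const)]
  rw [← volume_pos_ofReal_lt (μ {x | l < f x})]
  congr 1
  ext v
  simp only [mem_inter_iff, mem_ofPred_eq, volume_pos_ofReal_lt]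
  exact ⟨fun h => ⟨h.2.1, h.1⟩, fun h => ⟨h.2, h.1, h.2.trans_le (measure_mono (subset_univ _))⟩⟩

theorem rearr_rearr_halfLine (f : ℝ → ℝ≥0∞) (t : ℝ) :
    rearr (halfLine μ) (rearr (halfLine μ) f) t = rearr (halfLine μ) f t := by
  have := rearr_rearr (μ := halfLine μ) f t
  rwa [halfLine_halfLine] at this

theorem rearr_eq_zero_of_measure_univ_le (f : α → ℝ≥0∞) {t : ℝ} (h : μ univ ≤ ENNReal.ofReal t) :
    rearr μ f t = 0 :=
  nonpos_iff_eq_zero.1 (rearr_le_iff.2 ((measure_mono (subset_univ _)).trans h))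

theorem lintegral_eq_lintegral_measure_lt [SFinite μ] {f : α → ℝ≥0∞} (hf : Measurable f) :
    ∫⁻ x, f x ∂μ = ∫⁻ l in Ioi (0 : ℝ), μ {x | ENNReal.ofReal l < f x} := by
  have hset : MeasurableSet {p : α × ℝ | ENNReal.ofReal p.2 < f p.1} :=
    measurableSet_lt (ENNReal.measurable_ofReal.comp measurable_snd) (hf.comp measurable_fst)
  have h1 : ∀ x, f x = ∫⁻ l in Ioi (0 : ℝ),
      {p : α × ℝ | ENNReal.ofReal p.2 < f p.1}.indicator 1 (x, l) := by
    intro x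
    have hm : MeasurableSet {l : ℝ | ENNReal.ofReal l < f x} :=
      measurableSet_lt ENNReal.measurable_ofReal measurable_const
    have : ∀ l : ℝ, {p : α × ℝ | ENNReal.ofReal p.2 < f p.1}.indicator (1 : α × ℝ → ℝ≥0∞) (x, l)
        = {l : ℝ | ENNReal.ofReal l < f x}.indicator 1 l := fun l => rfl
    simp only [this]
    rw [lintegral_indicator_one hm, Measure.restrict_apply hm]
    conv_lhs => rw [← volume_pos_ofReal_lt (f x)]
    congr 1
    ext l
    simp [and_comm]
  have h2 : ∀ l : ℝ, μ {x | ENNReal.ofReal l < f x} =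
      ∫⁻ x, {p : α × ℝ | ENNReal.ofReal p.2 < f p.1}.indicator 1 (x, l) ∂μ := by
    intro l
    have hm : MeasurableSet {x : α | ENNReal.ofReal l < f x} := measurableSet_lt measurable_const hf
    rw [← lintegral_indicator_one hm]
    rfl
  rw [lintegral_congr h1, lintegral_congr h2]
  refine lintegral_lintegral_swap ?_
  exact (measurable_one.indicator hset).aemeasurable

/-- By the layer-cake formula it suffices to compare level by level: `μ ({f > l} ∩ E)` is at most
`min s (μ {f > l})`, which is the length of `{f^* > l}` in `(0, s)`. -/
theorem setLIntegral_le_lintegral_rearr [SigmaFinite μ] {f : α → ℝ≥0∞} (hf : Measurable f)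
    {E : Set α} {s : ℝ} (hE : μ E ≤ ENNReal.ofReal s) :
    ∫⁻ x in E, f x ∂μ ≤ ∫⁻ v in Ioo 0 s, rearr μ f v := by
  rw [lintegral_eq_lintegral_measure_lt hf, lintegral_eq_lintegral_measure_lt (measurable_rearr f)]
  refine lintegral_mono fun l => ?_
  have hm : MeasurableSet {x : α | ENNReal.ofReal l < f x} := measurableSet_lt measurable_const hf
  simp only [lt_rearr_iff]
  rw [Measure.restrict_apply hm, Measure.restrict_apply
    (measurableSet_lt ENNReal.measurable_ofReal measurable_const)]
  have : {v : ℝ | ENNReal.ofReal v < μ {x | ENNReal.ofReal l < f x}} ∩ Ioo 0 s =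
      {v : ℝ | 0 < v ∧ ENNReal.ofReal v <
        min (ENNReal.ofReal s) (μ {x | ENNReal.ofReal l < f x})} := by
    ext v
    simp only [mem_inter_iff, mem_ofPred_eq, mem_Ioo, lt_min_iff]
    constructor
    · rintro ⟨h1, h2, h3⟩
      exact ⟨h2, (ENNReal.ofReal_lt_ofReal_iff_of_nonneg h2.le).2 h3, h1⟩
    · rintro ⟨h1, h2, h3⟩
      exact ⟨h3, h1, (ENNReal.ofReal_lt_ofReal_iff_of_nonneg h1.le).1 h2⟩
  rw [this, volume_pos_ofReal_lt]
  exact le_min ((measure_mono inter_subset_right).trans hE) (measure_mono inter_subset_left)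

end Rearrangement

/-! ### Representation spaces realised through a length map -/

section Representation

variable {α : Type*} [MeasurableSpace α] {μ : Measure α}

/-- A measurable map onto `(0, μ(α))`, measure preserving on its domain. -/
structure LengthMap (μ : Measure α) where
  /-- the domain of the map -/
  carrier : Set α
  /-- the map -/
  toFun : α → ℝ
  measurableSet : MeasurableSet carrier
  measurable : Measurable toFun
  map_eq : (μ.restrict carrier).map toFun = halfLine μ

theorem exists_lengthMap [SigmaFinite μ] (hμ : Nonatomic μ) : Nonempty (LengthMap μ) :=
  let ⟨A, σ, hA, hσ, h⟩ := exists_map_eq_halfLine hμ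
  ⟨⟨A, σ, hA, hσ, h⟩⟩

namespace LengthMap

variable (L : LengthMap μ)

/-- The pull-back of a function on `(0, μ(α))`, extended by zero. -/
def pull (h : ℝ → ℝ≥0∞) : α → ℝ≥0∞ := L.carrier.indicator (h ∘ L.toFun)

theorem measurable_pull {h : ℝ → ℝ≥0∞} (hh : Measurable h) : Measurable (L.pull h) :=
  (hh.comp L.measurable).indicator L.measurableSet

theorem measure_pull_lt {h : ℝ → ℝ≥0∞} (hh : Measurable h) (l : ℝ≥0∞) :
    μ {x | l < L.pull h x} = halfLine μ {t | l < h t} := by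
  have hm : MeasurableSet {t | l < h t} := measurableSet_lt measurable_const hh
  rw [← L.map_eq, Measure.map_apply L.measurable hm, Measure.restrict_apply (L.measurable hm)]
  congr 1
  ext x
  by_cases hx : x ∈ L.carrier <;> simp [pull, hx]

theorem rearr_pull {h : ℝ → ℝ≥0∞} (hh : Measurable h) (t : ℝ) :
    rearr μ (L.pull h) t = rearr (halfLine μ) h t :=
  rearr_congr_measure (L.measure_pull_lt hh) t

theorem measure_lt_le (s : ℝ) : μ (L.carrier ∩ {x | L.toFun x < s}) ≤ ENNReal.ofReal s := by
  have := halfLine_Iio μ s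
  rw [← L.map_eq, Measure.map_apply L.measurable measurableSet_Iio,
    Measure.restrict_apply (L.measurable measurableSet_Iio), inter_comm] at this
  exact this.trans_le (min_le_left _ _)

/-- This is why pointwise estimates at positive arguments alone suffice throughout. -/
theorem ae_pos : ∀ᵐ x ∂μ, x ∈ L.carrier → 0 < L.toFun x := by
  have : halfLine μ (Iic 0) = 0 := by
    rw [halfLine_eq, Measure.restrict_apply measurableSet_Iic]
    convert measure_empty (μ := (volume : Measure ℝ))
    rw [eq_empty_iff_forall_notMem]
    rintro x ⟨h1, h2⟩
    exact absurd h2.1 (not_lt.2 h1)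
  rw [← L.map_eq, Measure.map_apply L.measurable measurableSet_Iic,
    Measure.restrict_apply (L.measurable measurableSet_Iic)] at this
  rw [ae_iff]
  convert this using 2
  ext x
  simp [and_comm]

theorem setLIntegral_pull {h : ℝ → ℝ≥0∞} (hh : Measurable h) (s : ℝ) :
    ∫⁻ x in L.carrier ∩ {x | L.toFun x < s}, L.pull h x ∂μ = ∫⁻ t in Iio s, h t ∂halfLine μ := by
  rw [← L.map_eq, setLIntegral_map measurableSet_Iio hh L.measurable,
    Measure.restrict_restrict (L.measurable measurableSet_Iio), inter_comm]
  refine setLIntegral_congr_fun ((L.measurable measurableSet_Iio).inter L.measurableSet)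
    fun x hx => ?_
  simp [pull, hx.2]

end LengthMap

namespace RINorm

theorem congr_ae (ρ : RINorm μ) {f g : α → ℝ≥0∞} (hf : Measurable f) (hg : Measurable g)
    (h : f =ᵐ[μ] g) : ρ.toFun f = ρ.toFun g :=
  le_antisymm (ρ.mono f g hf hg h.le) (ρ.mono g f hg hf h.symm.le)

/-- All competitors in the infimum are equimeasurable, so by rearrangement invariance the infimum is
over a constant. -/
theorem repr_eq_of_rearr_eq (ρ : RINorm μ) {g : α → ℝ≥0∞} {h : ℝ → ℝ≥0∞} (hg : Measurable g)
    (hgh : ∀ t : ℝ, 0 < t → rearr μ g t = rearr (halfLine μ) h t) : ρ.repr h = ρ.toFun g := by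
  refine le_antisymm (iInf₂_le_of_le g hg (iInf_le _ hgh)) ?_
  refine le_iInf fun g' => le_iInf fun hg' => le_iInf fun hgh' => ?_
  exact (ρ.rearr_eq g g' hg hg' fun t ht => (hgh t ht).trans (hgh' t ht).symm).le

theorem repr_eq_pull (ρ : RINorm μ) (L : LengthMap μ) {h : ℝ → ℝ≥0∞} (hh : Measurable h) :
    ρ.repr h = ρ.toFun (L.pull h) :=
  ρ.repr_eq_of_rearr_eq (L.measurable_pull hh) fun t _ => L.rearr_pull hh t

theorem repr_rearr (ρ : RINorm μ) {f : α → ℝ≥0∞} (hf : Measurable f) :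
    ρ.repr (rearr μ f) = ρ.toFun f :=
  ρ.repr_eq_of_rearr_eq hf fun t _ => (rearr_rearr f t).symm

theorem measurable_enorm (f : α →ₘ[μ] ℝ) : Measurable fun x => ‖f x‖ₑ :=
  f.measurable.enorm

theorem repr_rearrAbs (ρ : RINorm μ) (f : α →ₘ[μ] ℝ) : ρ.repr (rearrAbs f) = ρ.norm f :=
  ρ.repr_rearr (measurable_enorm f)

theorem repr_mono (ρ : RINorm μ) (L : LengthMap μ) {h k : ℝ → ℝ≥0∞} (hh : Measurable h)
    (hk : Measurable k) (hhk : ∀ t, 0 < t → h t ≤ k t) : ρ.repr h ≤ ρ.repr k := by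
  rw [ρ.repr_eq_pull L hh, ρ.repr_eq_pull L hk]
  refine ρ.mono _ _ (L.measurable_pull hh) (L.measurable_pull hk) ?_
  filter_upwards [L.ae_pos] with x hx
  by_cases hxA : x ∈ L.carrier
  · simpa [LengthMap.pull, hxA] using hhk _ (hx hxA)
  · simp [LengthMap.pull, hxA]

theorem repr_add_le (ρ : RINorm μ) (L : LengthMap μ) {h k : ℝ → ℝ≥0∞} (hh : Measurable h)
    (hk : Measurable k) : ρ.repr (fun t => h t + k t) ≤ ρ.repr h + ρ.repr k := by
  rw [ρ.repr_eq_pull L hh, ρ.repr_eq_pull L hk,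
    ρ.repr_eq_pull L (h := fun t => h t + k t) (hh.add hk)]
  refine le_of_eq_of_le ?_ (ρ.add_le _ _ (L.measurable_pull hh) (L.measurable_pull hk))
  congr 1
  ext x
  by_cases hxA : x ∈ L.carrier <;> simp [LengthMap.pull, hxA]

theorem repr_const_mul (ρ : RINorm μ) (L : LengthMap μ) (c : ℝ≥0) {h : ℝ → ℝ≥0∞}
    (hh : Measurable h) : ρ.repr (fun t => c * h t) = c * ρ.repr h := by
  rw [ρ.repr_eq_pull L hh, ρ.repr_eq_pull L (hh.const_mul _), ← ρ.smul c _ (L.measurable_pull hh)]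
  congr 1
  ext x
  by_cases hxA : x ∈ L.carrier <;> simp [LengthMap.pull, hxA]

/-- Finite norm forces integrability on each set of finite measure, and countably many of these
cover the space. -/
theorem ae_lt_top [SigmaFinite μ] (ρ : RINorm μ) {f : α → ℝ≥0∞} (hf : Measurable f)
    (h : ρ.toFun f < ∞) : ∀ᵐ x ∂μ, f x < ∞ := by
  have key : ∀ n, ∀ᵐ x ∂μ.restrict (spanningSets μ n), f x < ∞ := by
    intro n
    obtain ⟨C, hC⟩ := ρ.lintegral_le (spanningSets μ n) (measurableSet_spanningSets μ n)
      (measure_spanningSets_lt_top μ n)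
    exact MeasureTheory.ae_lt_top hf
      ((hC f hf).trans_lt (ENNReal.mul_lt_top ENNReal.coe_lt_top h)).ne
  have := (ae_restrict_iUnion_iff (μ := μ) (spanningSets μ) (fun x => f x < ∞)).2 key
  rwa [iUnion_spanningSets, Measure.restrict_univ] at this

/-- A function of finite norm is represented by a real function. -/
theorem exists_enorm_eq [SigmaFinite μ] (ρ : RINorm μ) {f : α → ℝ≥0∞} (hf : Measurable f)
    (h : ρ.toFun f < ∞) : ∃ g : α →ₘ[μ] ℝ, (fun x => ‖g x‖ₑ) =ᵐ[μ] f := by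
  refine ⟨AEEqFun.mk (fun x => (f x).toReal) hf.ennreal_toReal.aestronglyMeasurable, ?_⟩
  filter_upwards [ρ.ae_lt_top hf h, AEEqFun.coeFn_mk (fun x => (f x).toReal)
    hf.ennreal_toReal.aestronglyMeasurable] with x hx hx'
  rw [hx', Real.enorm_of_nonneg ENNReal.toReal_nonneg, ENNReal.ofReal_toReal hx.ne]

end RINorm

end Representation

/-! ### Hardy's inequality and power-weight estimates -/

section Hardy

theorem ofReal_rpow_mul_rpow {s : ℝ} (hs : 0 < s) (a b : ℝ) :
    ENNReal.ofReal (s ^ a) * ENNReal.ofReal (s ^ b) = ENNReal.ofReal (s ^ (a + b)) := by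
  rw [← ENNReal.ofReal_mul (by positivity), Real.rpow_add hs]

theorem ofReal_rpow_rpow {s : ℝ} (hs : 0 < s) (a b : ℝ) :
    ENNReal.ofReal (s ^ a) ^ b = ENNReal.ofReal (s ^ (a * b)) := by
  rw [ENNReal.ofReal_rpow_of_pos (by positivity), Real.rpow_mul hs.le]

@[fun_prop]
theorem measurable_ofReal_rpow (a : ℝ) : Measurable fun s : ℝ => ENNReal.ofReal (s ^ a) :=
  ENNReal.measurable_ofReal.comp (measurable_id.pow_const a)

theorem lintegral_Ioo_rpow {a u : ℝ} (ha : 0 < a) (hu : 0 ≤ u) :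
    ∫⁻ s in Ioo 0 u, ENNReal.ofReal (s ^ (a - 1)) = ENNReal.ofReal (u ^ a / a) := by
  have hi : IntegrableOn (fun s : ℝ => s ^ (a - 1)) (Ioc 0 u) :=
    (intervalIntegrable_iff_integrableOn_Ioc_of_le hu).1
      (intervalIntegral.intervalIntegrable_rpow' (by linarith))
  rw [← ofReal_integral_eq_lintegral_ofReal (hi.mono_set Ioo_subset_Ioc_self)
    (by filter_upwards [ae_restrict_mem measurableSet_Ioo] with s hs
        exact Real.rpow_nonneg hs.1.le _)]
  rw [← integral_Ioc_eq_integral_Ioo, ← intervalIntegral.integral_of_le hu,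
    integral_rpow (Or.inl (by linarith)), sub_add_cancel, Real.zero_rpow ha.ne', sub_zero]

theorem lintegral_Ioi_rpow {a u : ℝ} (ha : 0 < a) (hu : 0 < u) :
    ∫⁻ s in Ioi u, ENNReal.ofReal (s ^ (-a - 1)) = ENNReal.ofReal (u ^ (-a) / a) := by
  rw [← ofReal_integral_eq_lintegral_ofReal (integrableOn_Ioi_rpow_of_lt (by linarith) hu)
    (by filter_upwards [ae_restrict_mem measurableSet_Ioi] with s hs
        exact Real.rpow_nonneg (hu.trans hs).le _)]
  rw [integral_Ioi_rpow_of_lt (by linarith) hu, sub_add_cancel, neg_div_neg_eq]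

/-- The average of `φ` over `(0, s)`. -/
def mean (φ : ℝ → ℝ≥0∞) (s : ℝ) : ℝ≥0∞ := ENNReal.ofReal (s ^ (-1 : ℝ)) * ∫⁻ v in Ioo 0 s, φ v

theorem lintegral_Ioi_mul_lintegral_Ioo {K ψ : ℝ → ℝ≥0∞} (hK : Measurable K)
    (hψ : Measurable ψ) :
    ∫⁻ s in Ioi (0 : ℝ), K s * ∫⁻ v in Ioo 0 s, ψ v =
      ∫⁻ v in Ioi (0 : ℝ), ψ v * ∫⁻ s in Ioi v, K s := by
  have hset : MeasurableSet {p : ℝ × ℝ | p.2 < p.1} :=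
    measurableSet_lt measurable_snd measurable_fst
  let F : ℝ × ℝ → ℝ≥0∞ := {p : ℝ × ℝ | p.2 < p.1}.indicator fun p => K p.1 * ψ p.2
  have hF : Measurable F :=
    ((hK.comp measurable_fst).mul (hψ.comp measurable_snd)).indicator hset
  have h1 : ∀ s ∈ Ioi (0 : ℝ), K s * ∫⁻ v in Ioo 0 s, ψ v = ∫⁻ v in Ioi (0 : ℝ), F (s, v) := by
    intro s _
    have : ∀ v, F (s, v) = (Iio s).indicator (fun v => K s * ψ v) v := fun v => rfl
    simp only [this]
    rw [lintegral_indicator measurableSet_Iio, Measure.restrict_restrict measurableSet_Iio,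
      Iio_inter_Ioi, lintegral_const_mul _ hψ]
  have h2 : ∀ v ∈ Ioi (0 : ℝ), ψ v * ∫⁻ s in Ioi v, K s = ∫⁻ s in Ioi (0 : ℝ), F (s, v) := by
    intro v hv
    have : ∀ s, F (s, v) = (Ioi v).indicator (fun s => ψ v * K s) s := fun s => by
      simp only [F, indicator, mem_ofPred_eq, mem_Ioi, mul_comm]
    simp only [this]
    rw [lintegral_indicator measurableSet_Ioi, Measure.restrict_restrict measurableSet_Ioi,
      inter_eq_left.2 (Ioi_subset_Ioi (le_of_lt hv)), lintegral_const_mul _ hK]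
  rw [setLIntegral_congr_fun measurableSet_Ioi h1, setLIntegral_congr_fun measurableSet_Ioi h2]
  exact lintegral_lintegral_swap hF.aemeasurable

/-- Hölder's inequality after splitting `φ = (v^{(q-1)/p} φ^q)^{1/q} (v^{-1/p})^{1-1/q}`. -/
theorem lintegral_Ioo_rpow_le {φ : ℝ → ℝ≥0∞} (hφ : Measurable φ) {p q s : ℝ} (hp : 1 < p)
    (hq : 1 ≤ q) (hs : 0 < s) :
    (∫⁻ v in Ioo 0 s, φ v) ^ q ≤ ENNReal.ofReal (s ^ (1 - 1 / p) / (1 - 1 / p)) ^ (q - 1) *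
      ∫⁻ v in Ioo 0 s, ENNReal.ofReal (v ^ ((q - 1) / p)) * φ v ^ q := by
  have hq0 : 0 < q := by linarith
  have ha : 0 < 1 - 1 / p := by rw [sub_pos, div_lt_one (by linarith)]; exact hp
  have hb := lintegral_Ioo_rpow ha hs.le
  rw [← hb]
  -- The form of Hölder with exponents `1/q` and `1 - 1/q` includes `q = 1`, where the conjugate
  -- exponent would be infinite.
  have key := ENNReal.lintegral_mul_norm_pow_le (μ := volume.restrict (Ioo 0 s))
    (f := fun v => ENNReal.ofReal (v ^ ((q - 1) / p)) * φ v ^ q)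
    (g := fun v => ENNReal.ofReal (v ^ (1 - 1 / p - 1)))
    (by fun_prop) (by fun_prop) (p := 1 / q) (q := 1 - 1 / q) (by positivity)
    (by rw [sub_nonneg, div_le_one hq0]; exact hq) (by ring)
  have hcongr : ∫⁻ v in Ioo 0 s, (ENNReal.ofReal (v ^ ((q - 1) / p)) * φ v ^ q) ^ (1 / q) *
      ENNReal.ofReal (v ^ (1 - 1 / p - 1)) ^ (1 - 1 / q) = ∫⁻ v in Ioo 0 s, φ v := by
    refine setLIntegral_congr_fun measurableSet_Ioo fun v hv => ?_
    have hv : 0 < v := hv.1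
    rw [ENNReal.mul_rpow_of_nonneg _ _ (by positivity), ← ENNReal.rpow_mul,
      mul_one_div_cancel hq0.ne', ENNReal.rpow_one, ofReal_rpow_rpow hv, ofReal_rpow_rpow hv,
      mul_right_comm, ofReal_rpow_mul_rpow hv]
    have : (q - 1) / p * (1 / q) + (1 - 1 / p - 1) * (1 - 1 / q) = 0 := by
      have : p ≠ 0 := by linarith
      field_simp
      ring
    rw [this, Real.rpow_zero, ENNReal.ofReal_one, one_mul]
  rw [hcongr] at key
  calc (∫⁻ v in Ioo 0 s, φ v) ^ q ≤ _ := ENNReal.rpow_le_rpow key hq0.le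
    _ = _ := by
      rw [ENNReal.mul_rpow_of_nonneg _ _ hq0.le, ← ENNReal.rpow_mul, ← ENNReal.rpow_mul,
        one_div_mul_cancel hq0.ne', ENNReal.rpow_one, mul_comm]
      congr 2
      field_simp

/-- Hardy's inequality with power weights. -/
theorem hardy {φ : ℝ → ℝ≥0∞} (hφ : Measurable φ) {p q : ℝ} (hp : 1 < p) (hq : 1 ≤ q) :
    ∫⁻ s in Ioi (0 : ℝ), ENNReal.ofReal (s ^ (q / p - 1)) * mean φ s ^ q ≤
      ENNReal.ofReal (1 / (1 - 1 / p)) ^ q *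
        ∫⁻ s in Ioi (0 : ℝ), ENNReal.ofReal (s ^ (q / p - 1)) * φ s ^ q := by
  have hq0 : 0 < q := by linarith
  have hp0 : 0 < p := by linarith
  have ha : 0 < 1 - 1 / p := by rw [sub_pos, div_lt_one (by linarith)]; exact hp
  set a := 1 - 1 / p with hadef
  set c := ENNReal.ofReal (1 / a) with hc
  have hψ : Measurable fun v => ENNReal.ofReal (v ^ ((q - 1) / p)) * φ v ^ q := by fun_prop
  calc ∫⁻ s in Ioi (0 : ℝ), ENNReal.ofReal (s ^ (q / p - 1)) * mean φ s ^ q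
      ≤ ∫⁻ s in Ioi (0 : ℝ), c ^ (q - 1) * (ENNReal.ofReal (s ^ (-a - 1)) *
          ∫⁻ v in Ioo 0 s, ENNReal.ofReal (v ^ ((q - 1) / p)) * φ v ^ q) := by
        refine setLIntegral_mono' measurableSet_Ioi fun s hs => ?_
        have hs : 0 < s := hs
        rw [mean, ENNReal.mul_rpow_of_nonneg _ _ hq0.le, ofReal_rpow_rpow hs, ← mul_assoc,
          ofReal_rpow_mul_rpow hs]
        refine (mul_le_mul_right (lintegral_Ioo_rpow_le hφ hp hq hs) _).trans_eq ?_
        rw [← hadef, div_eq_mul_one_div (s ^ a), ENNReal.ofReal_mul (by positivity),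
          ENNReal.mul_rpow_of_nonneg _ _ (by linarith), ofReal_rpow_rpow hs, ← hc]
        have : -a - 1 = q / p - 1 + -1 * q + a * (q - 1) := by
          rw [hadef]; field_simp; ring
        rw [this, ← ofReal_rpow_mul_rpow hs (q / p - 1 + -1 * q)]
        ring
    -- Tonelli. The inner integral equals `c v^{-a}` and supplies the last factor of `c ^ q`; the
    -- others came from Hölder.
    _ = c ^ (q - 1) * ∫⁻ v in Ioi (0 : ℝ), ENNReal.ofReal (v ^ ((q - 1) / p)) * φ v ^ q *
          ∫⁻ s in Ioi v, ENNReal.ofReal (s ^ (-a - 1)) := by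
        rw [lintegral_const_mul', lintegral_Ioi_mul_lintegral_Ioo (by fun_prop) hψ]
        exact (ENNReal.rpow_lt_top_of_nonneg (by linarith) ENNReal.ofReal_ne_top).ne
    _ = c ^ (q - 1) * ∫⁻ v in Ioi (0 : ℝ), c * (ENNReal.ofReal (v ^ (q / p - 1)) * φ v ^ q) := by
        congr 1
        refine setLIntegral_congr_fun measurableSet_Ioi fun v hv => ?_
        have hv : 0 < v := hv
        rw [lintegral_Ioi_rpow ha hv, div_eq_mul_one_div (v ^ (-a)),
          ENNReal.ofReal_mul (by positivity), ← hc]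
        have : q / p - 1 = (q - 1) / p + -a := by rw [hadef]; field_simp; ring
        rw [this, ← ofReal_rpow_mul_rpow hv]
        ring
    _ = _ := by
        rw [lintegral_const_mul' _ _ ENNReal.ofReal_ne_top, ← mul_assoc]
        congr 1
        have hc0 : c ≠ 0 := by
          rw [hc, Ne, ENNReal.ofReal_eq_zero, not_le]; positivity
        calc c ^ (q - 1) * c = c ^ (q - 1) * c ^ (1 : ℝ) := by rw [ENNReal.rpow_one]
          _ = c ^ q := by rw [← ENNReal.rpow_add _ _ hc0 ENNReal.ofReal_ne_top, sub_add_cancel]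

/-- The embedding `L^{p,q} ⊂ L^{p,∞}`, localised to `(0, s)`: there `φ` is at least `φ s`. -/
theorem rpow_mul_antitone_le {φ : ℝ → ℝ≥0∞} (hφ : Antitone φ) {p q s : ℝ} (hp : 0 < p)
    (hq : 0 < q) (hs : 0 < s) :
    ENNReal.ofReal (s ^ (1 / p)) * φ s ≤ ENNReal.ofReal ((q / p) ^ (1 / q)) *
      (∫⁻ t in Ioo 0 s, ENNReal.ofReal (t ^ (q / p - 1)) * φ t ^ q) ^ (1 / q) := by
  have hqp : 0 < q / p := by positivity
  have h1 : ENNReal.ofReal (s ^ (q / p) / (q / p)) * φ s ^ q ≤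
      ∫⁻ t in Ioo 0 s, ENNReal.ofReal (t ^ (q / p - 1)) * φ t ^ q := by
    rw [← lintegral_Ioo_rpow hqp hs.le, ← lintegral_mul_const _ (by fun_prop)]
    refine setLIntegral_mono' measurableSet_Ioo fun t ht => ?_
    gcongr
    exact hφ ht.2.le
  have h2 := ENNReal.rpow_le_rpow h1 (show 0 ≤ 1 / q by positivity)
  refine le_trans (le_of_eq ?_) (mul_le_mul_right h2 _)
  rw [ENNReal.mul_rpow_of_nonneg _ _ (by positivity), ← ENNReal.rpow_mul,
    mul_one_div_cancel hq.ne', ENNReal.rpow_one, ← mul_assoc,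
    ENNReal.ofReal_rpow_of_pos (by positivity), ← ENNReal.ofReal_mul (by positivity),
    ← Real.mul_rpow (by positivity) (by positivity), mul_div_cancel₀ _ hqp.ne',
    ← Real.rpow_mul hs.le]
  congr 3
  field_simp

theorem mean_le_of_rpow_mul_le {φ : ℝ → ℝ≥0∞} {p s : ℝ} (hp : 1 < p) (hs : 0 < s) {N : ℝ≥0∞}
    (h : ∀ v, 0 < v → ENNReal.ofReal (v ^ (1 / p)) * φ v ≤ N) :
    mean φ s ≤ ENNReal.ofReal (1 / (1 - 1 / p)) * ENNReal.ofReal (s ^ (-(1 / p))) * N := by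
  have ha : 0 < 1 - 1 / p := by rw [sub_pos, div_lt_one (by linarith)]; exact hp
  have h1 : ∫⁻ v in Ioo 0 s, φ v ≤ ENNReal.ofReal (s ^ (1 - 1 / p) / (1 - 1 / p)) * N := by
    rw [← lintegral_Ioo_rpow ha hs.le, ← lintegral_mul_const _ (by fun_prop)]
    refine setLIntegral_mono' measurableSet_Ioo fun v hv => ?_
    refine le_trans (le_of_eq ?_) (mul_le_mul_right (h v hv.1) _)
    rw [← mul_assoc, ofReal_rpow_mul_rpow hv.1]
    simp
  rw [mean]
  refine (mul_le_mul_right h1 _).trans_eq ?_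
  rw [div_eq_mul_one_div (s ^ _), ENNReal.ofReal_mul (by positivity), ← mul_assoc, ← mul_assoc,
    ofReal_rpow_mul_rpow hs, mul_comm (ENNReal.ofReal (1 / (1 - 1 / p)))]
  congr 4
  ring

theorem mean_le_lintegral_rpow {φ : ℝ → ℝ≥0∞} (hφ : Measurable φ) {q s : ℝ} (hq : 1 ≤ q)
    (hs : 0 < s) :
    mean φ s ≤ ENNReal.ofReal (s ^ (-(1 / q))) *
      ∫⁻ v in Ioi (0 : ℝ), ENNReal.ofReal (v ^ (1 / q - 1)) * φ v := by
  have h1 : ENNReal.ofReal (s ^ (1 / q - 1)) * ∫⁻ v in Ioo 0 s, φ v ≤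
      ∫⁻ v in Ioi (0 : ℝ), ENNReal.ofReal (v ^ (1 / q - 1)) * φ v := by
    rw [← lintegral_const_mul _ hφ]
    refine le_trans ?_ (lintegral_mono_set (show Ioo 0 s ⊆ Ioi 0 from Ioo_subset_Ioi_self))
    refine setLIntegral_mono' measurableSet_Ioo fun v hv => ?_
    refine mul_le_mul_left (ENNReal.ofReal_le_ofReal
      (Real.rpow_le_rpow_of_nonpos hv.1 hv.2.le ?_)) _
    rw [sub_nonpos, div_le_one (by linarith)]; exact hq
  refine le_trans (le_of_eq ?_) (mul_le_mul_right h1 _)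
  rw [mean, ← mul_assoc, ofReal_rpow_mul_rpow hs]
  congr 3
  ring

end Hardy

/-! ### The functionals `R` and `S` on means -/

section Functionals

variable {w φ : ℝ → ℝ≥0∞} {p₀ q₀ p₁ q t : ℝ}

/-- The identity that dictates `r`: the factor `u^{1/p₀-1/q}` at `u = t^r` is exactly `t^{1/p₁}`. -/
theorem slope_mul (hp₀ : 1 < p₀) (hq : p₀ < q) (hp₁ : 1 < p₁) :
    slope p₀ p₁ q * (1 / p₀ - 1 / q) = 1 / p₁ := by
  have : q - p₀ ≠ 0 := by linarith
  have : q ≠ 0 := by linarith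
  have : p₀ ≠ 0 := by linarith
  have : p₁ ≠ 0 := by linarith
  unfold slope
  field_simp

/-- The functional of `calderonR` applied to a function that need not be a rearrangement. -/
def hardyR (p₀ q₀ p₁ q : ℝ) (w : ℝ → ℝ≥0∞) (t : ℝ) : ℝ≥0∞ :=
  ENNReal.ofReal (t ^ (-(1 / p₁))) *
    (∫⁻ s in Ioo (0 : ℝ) (t ^ slope p₀ p₁ q),
      ENNReal.ofReal (s ^ (q₀ / p₀ - 1)) * w s ^ q₀) ^ (1 / q₀)

/-- The functional of `calderonS` applied to a function that need not be a rearrangement. -/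
def hardyS (p₀ p₁ q : ℝ) (w : ℝ → ℝ≥0∞) (t : ℝ) : ℝ≥0∞ :=
  ∫⁻ s in Ioi (t ^ slope p₀ p₁ q), ENNReal.ofReal (s ^ (1 / q - 1)) * w s

theorem measurable_hardyR : Measurable (hardyR p₀ q₀ p₁ q w) := by
  have h : Monotone fun u : ℝ => ∫⁻ s in Ioo (0 : ℝ) u,
      ENNReal.ofReal (s ^ (q₀ / p₀ - 1)) * w s ^ q₀ := fun u v huv =>
    lintegral_mono_set (Ioo_subset_Ioo_right huv)
  exact (measurable_ofReal_rpow _).mul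
    ((h.measurable.comp (measurable_id.pow_const _)).pow_const _)

theorem measurable_hardyS : Measurable (hardyS p₀ p₁ q w) := by
  have h : Antitone fun u : ℝ => ∫⁻ s in Ioi u, ENNReal.ofReal (s ^ (1 / q - 1)) * w s :=
    fun u v huv => lintegral_mono_set (Ioi_subset_Ioi huv)
  exact h.measurable.comp (measurable_id.pow_const _)

theorem hardyR_mono {w' : ℝ → ℝ≥0∞} (hq₀ : 0 ≤ q₀) (h : ∀ s, 0 < s → w s ≤ w' s) (t : ℝ) :
    hardyR p₀ q₀ p₁ q w t ≤ hardyR p₀ q₀ p₁ q w' t := by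
  unfold hardyR
  refine mul_le_mul_right (ENNReal.rpow_le_rpow ?_ (by positivity)) _
  refine setLIntegral_mono' measurableSet_Ioo fun s hs => ?_
  gcongr
  exact h s hs.1

theorem hardyS_mono {w' : ℝ → ℝ≥0∞} (h : ∀ s, 0 < s → w s ≤ w' s) (ht : 0 < t) :
    hardyS p₀ p₁ q w t ≤ hardyS p₀ p₁ q w' t := by
  refine setLIntegral_mono' measurableSet_Ioi fun s hs => ?_
  gcongr
  exact h s ((Real.rpow_pos_of_pos ht _).trans hs)

theorem hardyR_const_mul (hq₀ : 1 ≤ q₀) (hw : Measurable w) (c : ℝ≥0∞) (t : ℝ) :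
    hardyR p₀ q₀ p₁ q (fun s => c * w s) t = c * hardyR p₀ q₀ p₁ q w t := by
  have h0 : 0 < q₀ := by linarith
  unfold hardyR
  have : ∀ s, ENNReal.ofReal (s ^ (q₀ / p₀ - 1)) * (c * w s) ^ q₀ =
      c ^ q₀ * (ENNReal.ofReal (s ^ (q₀ / p₀ - 1)) * w s ^ q₀) := fun s => by
    rw [ENNReal.mul_rpow_of_nonneg _ _ h0.le]; ring
  simp only [this]
  rw [lintegral_const_mul _ (by fun_prop), ENNReal.mul_rpow_of_nonneg _ _ (by positivity),
    ← ENNReal.rpow_mul, mul_one_div_cancel h0.ne', ENNReal.rpow_one]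
  ring

theorem hardyS_const_mul (hw : Measurable w) (c : ℝ≥0∞) (t : ℝ) :
    hardyS p₀ p₁ q (fun s => c * w s) t = c * hardyS p₀ p₁ q w t := by
  unfold hardyS
  rw [← lintegral_const_mul _ (by fun_prop)]
  exact lintegral_congr fun s => by ring

theorem hardyR_add_le {w' : ℝ → ℝ≥0∞} (hq₀ : 1 ≤ q₀) (hw : Measurable w) (hw' : Measurable w')
    (t : ℝ) : hardyR p₀ q₀ p₁ q (fun s => w s + w' s) t ≤
      hardyR p₀ q₀ p₁ q w t + hardyR p₀ q₀ p₁ q w' t := by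
  have h0 : 0 < q₀ := by linarith
  unfold hardyR
  rw [← mul_add]
  gcongr
  have key := ENNReal.lintegral_Lp_add_le
    (μ := volume.restrict (Ioo (0 : ℝ) (t ^ slope p₀ p₁ q)))
    (f := fun s => ENNReal.ofReal (s ^ (q₀ / p₀ - 1)) ^ (1 / q₀) * w s)
    (g := fun s => ENNReal.ofReal (s ^ (q₀ / p₀ - 1)) ^ (1 / q₀) * w' s)
    (by fun_prop) (by fun_prop) hq₀
  have h : ∀ (s : ℝ) (x : ℝ≥0∞), (ENNReal.ofReal (s ^ (q₀ / p₀ - 1)) ^ (1 / q₀) * x) ^ q₀ =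
      ENNReal.ofReal (s ^ (q₀ / p₀ - 1)) * x ^ q₀ := fun s x => by
    rw [ENNReal.mul_rpow_of_nonneg _ _ h0.le, ← ENNReal.rpow_mul, one_div_mul_cancel h0.ne',
      ENNReal.rpow_one]
  simpa only [Pi.add_apply, ← mul_add, h] using key

theorem hardyS_add_le {w' : ℝ → ℝ≥0∞} (hw : Measurable w) (t : ℝ) :
    hardyS p₀ p₁ q (fun s => w s + w' s) t ≤ hardyS p₀ p₁ q w t + hardyS p₀ p₁ q w' t := by
  unfold hardyS
  rw [← lintegral_add_left (by fun_prop)]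
  exact lintegral_mono fun s => by rw [mul_add]

theorem hardyR_mean_le (hp₀ : 1 < p₀) (hq₀ : 1 ≤ q₀) (hφ : Measurable φ) (t : ℝ) :
    hardyR p₀ q₀ p₁ q (mean φ) t ≤ ENNReal.ofReal (1 / (1 - 1 / p₀)) *
      ENNReal.ofReal (t ^ (-(1 / p₁))) *
      (∫⁻ s in Ioi (0 : ℝ), ENNReal.ofReal (s ^ (q₀ / p₀ - 1)) * φ s ^ q₀) ^ (1 / q₀) := by
  have h0 : 0 < q₀ := by linarith
  unfold hardyR
  rw [mul_comm (ENNReal.ofReal (1 / (1 - 1 / p₀))), mul_assoc]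
  gcongr
  refine (ENNReal.rpow_le_rpow ((lintegral_mono_set Ioo_subset_Ioi_self).trans
    (hardy hφ hp₀ hq₀)) (by positivity)).trans_eq ?_
  rw [ENNReal.mul_rpow_of_nonneg _ _ (by positivity), ← ENNReal.rpow_mul,
    mul_one_div_cancel h0.ne', ENNReal.rpow_one]

/-- Since `mean φ s ≤ s^{-1/q} N`, the inner integral is that of a pure power, and by `slope_mul`
the result cancels the prefactor `t^{-1/p₁}`. -/
theorem hardyR_mean_le_const (hp₀ : 1 < p₀) (hq : p₀ < q) (hp₁ : 1 < p₁) (hq₀ : 1 ≤ q₀)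
    (hφ : Measurable φ) (ht : 0 < t) :
    hardyR p₀ q₀ p₁ q (mean φ) t ≤ ENNReal.ofReal ((1 / (q₀ * (1 / p₀ - 1 / q))) ^ (1 / q₀)) *
      ∫⁻ s in Ioi (0 : ℝ), ENNReal.ofReal (s ^ (1 / q - 1)) * φ s := by
  have h0 : 0 < q₀ := by linarith
  have hδ : 0 < 1 / p₀ - 1 / q := sub_pos.2 (one_div_lt_one_div_of_lt (by linarith) hq)
  set δ := 1 / p₀ - 1 / q with hδdef
  set N := ∫⁻ s in Ioi (0 : ℝ), ENNReal.ofReal (s ^ (1 / q - 1)) * φ s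
  set u := t ^ slope p₀ p₁ q with hu
  have hupos : 0 < u := Real.rpow_pos_of_pos ht _
  have h1 : ∫⁻ s in Ioo (0 : ℝ) u, ENNReal.ofReal (s ^ (q₀ / p₀ - 1)) * mean φ s ^ q₀ ≤
      ENNReal.ofReal (u ^ (q₀ * δ) / (q₀ * δ)) * N ^ q₀ := by
    rw [← lintegral_Ioo_rpow (by positivity) hupos.le, ← lintegral_mul_const _ (by fun_prop)]
    refine setLIntegral_mono' measurableSet_Ioo fun s hs => ?_
    refine (mul_le_mul_right (ENNReal.rpow_le_rpow
      (mean_le_lintegral_rpow (q := q) hφ (by linarith) hs.1) h0.le) _).trans_eq ?_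
    rw [ENNReal.mul_rpow_of_nonneg _ _ h0.le, ← mul_assoc, ofReal_rpow_rpow hs.1,
      ofReal_rpow_mul_rpow hs.1]
    congr 3
    rw [hδdef]; ring
  unfold hardyR
  refine (mul_le_mul_right (ENNReal.rpow_le_rpow h1 (by positivity)) _).trans_eq ?_
  rw [ENNReal.mul_rpow_of_nonneg _ _ (by positivity), ← ENNReal.rpow_mul,
    mul_one_div_cancel h0.ne', ENNReal.rpow_one, ← mul_assoc,
    div_eq_mul_one_div (u ^ (q₀ * δ)), ENNReal.ofReal_mul (by positivity),
    ENNReal.mul_rpow_of_nonneg _ _ (by positivity),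
    ofReal_rpow_rpow hupos, ENNReal.ofReal_rpow_of_pos (by positivity), ← mul_assoc, hu,
    ← Real.rpow_mul ht.le, ofReal_rpow_mul_rpow ht]
  have : -(1 / p₁) + slope p₀ p₁ q * (q₀ * δ * (1 / q₀)) = 0 := by
    rw [mul_right_comm, mul_one_div_cancel h0.ne', one_mul, hδdef, slope_mul hp₀ hq hp₁]; ring
  rw [this, Real.rpow_zero, ENNReal.ofReal_one, one_mul]

/-- A weak-type hypothesis is enough: `mean φ s` is then `O(s^{-1/p₀})`, and the tail integral
converges because `p₀ < q`. -/
theorem hardyS_mean_le (hp₀ : 1 < p₀) (hq : p₀ < q) (hp₁ : 1 < p₁) (ht : 0 < t) {N : ℝ≥0∞}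
    (h : ∀ v, 0 < v → ENNReal.ofReal (v ^ (1 / p₀)) * φ v ≤ N) :
    hardyS p₀ p₁ q (mean φ) t ≤ ENNReal.ofReal (1 / (1 / p₀ - 1 / q)) *
      ENNReal.ofReal (1 / (1 - 1 / p₀)) * ENNReal.ofReal (t ^ (-(1 / p₁))) * N := by
  have hδ : 0 < 1 / p₀ - 1 / q := sub_pos.2 (one_div_lt_one_div_of_lt (by linarith) hq)
  set δ := 1 / p₀ - 1 / q with hδdef
  set u := t ^ slope p₀ p₁ q with hu
  have hupos : 0 < u := Real.rpow_pos_of_pos ht _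
  unfold hardyS
  calc ∫⁻ s in Ioi u, ENNReal.ofReal (s ^ (1 / q - 1)) * mean φ s
      ≤ ∫⁻ s in Ioi u, ENNReal.ofReal (s ^ (-δ - 1)) *
          (ENNReal.ofReal (1 / (1 - 1 / p₀)) * N) := by
        refine setLIntegral_mono' measurableSet_Ioi fun s hs => ?_
        have hs : 0 < s := hupos.trans hs
        refine (mul_le_mul_right (mean_le_of_rpow_mul_le hp₀ hs h) _).trans_eq ?_
        have : -δ - 1 = (1 / q - 1) + -(1 / p₀) := by rw [hδdef]; ring
        rw [this, ← ofReal_rpow_mul_rpow hs]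
        ring
    _ = _ := by
        rw [lintegral_mul_const _ (by fun_prop), lintegral_Ioi_rpow hδ hupos,
          div_eq_mul_one_div (u ^ (-δ)), ENNReal.ofReal_mul (by positivity), hu,
          ← Real.rpow_mul ht.le, mul_neg, hδdef,
          slope_mul hp₀ hq hp₁]
        ring

theorem hardyS_mean_le_const (hq : 1 < q) (hφ : Measurable φ) (ht : 0 < t) :
    hardyS p₀ p₁ q (mean φ) t ≤ ENNReal.ofReal (1 / (1 - 1 / q)) *
      ∫⁻ s in Ioi (0 : ℝ), ENNReal.ofReal (s ^ (1 / q - 1)) * φ s := by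
  have := hardy hφ hq le_rfl
  simp only [ENNReal.rpow_one] at this
  exact (lintegral_mono_set (Ioi_subset_Ioi (Real.rpow_pos_of_pos ht _).le)).trans this

end Functionals

/-! ### Averages over initial segments, a sublinear substitute for the rearrangement -/

section Average

variable {α : Type*} [MeasurableSpace α] {μ : Measure α} (L : LengthMap μ)

/-- The average of `g` over the set of points sent into `(0, s)`. -/
def LengthMap.avg (g : α → ℝ≥0∞) (s : ℝ) : ℝ≥0∞ :=
  ENNReal.ofReal (s ^ (-1 : ℝ)) * ∫⁻ x in L.carrier ∩ {x | L.toFun x < s}, g x ∂μ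

namespace LengthMap

@[fun_prop]
theorem measurable_avg (g : α → ℝ≥0∞) : Measurable (L.avg g) := by
  have h : Monotone fun s : ℝ => ∫⁻ x in L.carrier ∩ {x | L.toFun x < s}, g x ∂μ :=
    fun s t hst => lintegral_mono_set fun x hx => ⟨hx.1, lt_of_lt_of_le hx.2 hst⟩
  exact (measurable_ofReal_rpow _).mul h.measurable

theorem avg_le_mean [SigmaFinite μ] {g : α → ℝ≥0∞} (hg : Measurable g) (s : ℝ) :
    L.avg g s ≤ mean (rearr μ g) s :=
  mul_le_mul_right (setLIntegral_le_lintegral_rearr hg (L.measure_lt_le s)) _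

theorem avg_mono {g h : α → ℝ≥0∞} (hgh : g ≤ᵐ[μ] h) (s : ℝ) : L.avg g s ≤ L.avg h s :=
  mul_le_mul_right (lintegral_mono_ae (ae_restrict_of_ae hgh)) _

theorem avg_congr {g h : α → ℝ≥0∞} (hgh : g =ᵐ[μ] h) : L.avg g = L.avg h :=
  funext fun s => le_antisymm (L.avg_mono hgh.le s) (L.avg_mono hgh.symm.le s)

theorem avg_add {g : α → ℝ≥0∞} (hg : Measurable g) (h : α → ℝ≥0∞) (s : ℝ) :
    L.avg (fun x => g x + h x) s = L.avg g s + L.avg h s := by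
  rw [avg, avg, avg, lintegral_add_left hg, mul_add]

theorem avg_const_mul {g : α → ℝ≥0∞} (hg : Measurable g) (c : ℝ≥0∞) (s : ℝ) :
    L.avg (fun x => c * g x) s = c * L.avg g s := by
  rw [avg, avg, lintegral_const_mul _ hg]
  ring

/-- On pulled-back nonincreasing functions the average loses nothing. For `s` beyond the total mass,
where the segment is shorter than `s`, the left side vanishes. -/
theorem rearr_le_avg_pull (f : ℝ → ℝ≥0∞) {s : ℝ} (hs : 0 < s) :
    rearr (halfLine μ) f s ≤ L.avg (L.pull (rearr (halfLine μ) f)) s := by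
  rcases le_total (μ univ) (ENNReal.ofReal s) with h | h
  · rw [rearr_eq_zero_of_measure_univ_le f (by rwa [halfLine_univ])]
    exact zero_le
  rw [avg, L.setLIntegral_pull (measurable_rearr f)]
  have h1 : rearr (halfLine μ) f s * ENNReal.ofReal s ≤
      ∫⁻ t in Iio s, rearr (halfLine μ) f t ∂halfLine μ := by
    rw [← min_eq_left h, ← halfLine_Iio, ← setLIntegral_const]
    exact setLIntegral_mono' measurableSet_Iio fun t ht => rearr_antitone f (le_of_lt ht)
  refine le_trans (le_of_eq ?_) (mul_le_mul_right h1 _)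
  rw [mul_left_comm, ← ENNReal.ofReal_mul (by positivity), Real.rpow_neg_one,
    inv_mul_cancel₀ hs.ne', ENNReal.ofReal_one, mul_one]

theorem avg_enorm_add_le (f g : α →ₘ[μ] ℝ) (s : ℝ) :
    L.avg (fun x => ‖(f + g) x‖ₑ) s ≤ L.avg (fun x => ‖f x‖ₑ) s + L.avg (fun x => ‖g x‖ₑ) s := by
  rw [← L.avg_add (RINorm.measurable_enorm f)]
  refine L.avg_mono ?_ s
  filter_upwards [AEEqFun.coeFn_add f g] with x hx
  rw [hx]
  exact enorm_add_le _ _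

theorem avg_enorm_smul (a : ℝ) (f : α →ₘ[μ] ℝ) :
    L.avg (fun x => ‖(a • f) x‖ₑ) = fun s => ‖a‖ₑ * L.avg (fun x => ‖f x‖ₑ) s := by
  ext s
  rw [← L.avg_const_mul (RINorm.measurable_enorm f)]
  refine congrFun (L.avg_congr ?_) s
  filter_upwards [AEEqFun.coeFn_smul a f] with x hx
  rw [hx, Pi.smul_apply, enorm_smul]

end LengthMap

end Average

/-! ### A common interface for the two functionals -/

/-- Sublinear functionals of positive functions on the half-line that satisfy the two endpoint
estimates on averages. -/
structure EndpointFunctional (p₀ q₀ p₁ q : ℝ) (Φ : (ℝ → ℝ≥0∞) → ℝ → ℝ≥0∞) : Prop where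
  meas : ∀ w, Measurable (Φ w)
  mono : ∀ w w', (∀ s, 0 < s → w s ≤ w' s) → ∀ t, 0 < t → Φ w t ≤ Φ w' t
  add_le : ∀ w w', Measurable w → Measurable w' → ∀ t, Φ (fun s => w s + w' s) t ≤ Φ w t + Φ w' t
  const_mul : ∀ (c : ℝ≥0∞) w, Measurable w → ∀ t, Φ (fun s => c * w s) t = c * Φ w t
  weak_bound : ∃ C : ℝ≥0, ∀ φ : ℝ → ℝ≥0∞, Antitone φ → ∀ t, 0 < t →
    Φ (mean φ) t ≤ C * ENNReal.ofReal (t ^ (-(1 / p₁))) *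
      (∫⁻ s in Ioi (0 : ℝ), ENNReal.ofReal (s ^ (q₀ / p₀ - 1)) * φ s ^ q₀) ^ (1 / q₀)
  strong_bound : ∃ C : ℝ≥0, ∀ φ : ℝ → ℝ≥0∞, Antitone φ → ∀ t, 0 < t →
    Φ (mean φ) t ≤ C * ∫⁻ s in Ioi (0 : ℝ), ENNReal.ofReal (s ^ (1 / q - 1)) * φ s

section Functional

variable {p₀ q₀ p₁ q : ℝ}

theorem endpointFunctional_hardyR (hp₀ : 1 < p₀) (hq : p₀ < q) (hp₁ : 1 < p₁) (hq₀ : 1 ≤ q₀) :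
    EndpointFunctional p₀ q₀ p₁ q (hardyR p₀ q₀ p₁ q) where
  meas _ := measurable_hardyR
  mono _ _ h t _ := hardyR_mono (by linarith) h t
  add_le _ _ hw hw' t := hardyR_add_le hq₀ hw hw' t
  const_mul c _ hw t := hardyR_const_mul hq₀ hw c t
  weak_bound := ⟨_, fun _ hφ t _ => hardyR_mean_le hp₀ hq₀ hφ.measurable t⟩
  strong_bound := ⟨_, fun _ hφ _ ht => hardyR_mean_le_const hp₀ hq hp₁ hq₀ hφ.measurable ht⟩

theorem endpointFunctional_hardyS (hp₀ : 1 < p₀) (hq : p₀ < q) (hp₁ : 1 < p₁) (hq₀ : 1 ≤ q₀) :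
    EndpointFunctional p₀ q₀ p₁ q (hardyS p₀ p₁ q) where
  meas _ := measurable_hardyS
  mono _ _ h _ ht := hardyS_mono h ht
  add_le _ _ hw _ t := hardyS_add_le hw t
  const_mul c _ hw t := hardyS_const_mul hw c t
  weak_bound := by
    refine ⟨(1 / (1 / p₀ - 1 / q)).toNNReal * (1 / (1 - 1 / p₀)).toNNReal *
      ((q₀ / p₀) ^ (1 / q₀)).toNNReal, fun φ hφ t ht => ?_⟩
    refine (hardyS_mean_le hp₀ hq hp₁ ht fun v hv =>
      (rpow_mul_antitone_le hφ (p := p₀) (q := q₀) (by linarith) (by linarith) hv).trans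
        (mul_le_mul_right (ENNReal.rpow_le_rpow (lintegral_mono_set Ioo_subset_Ioi_self)
          (by positivity)) _)).trans_eq ?_
    simp only [ENNReal.coe_mul, ENNReal.ofReal]
    ring
  strong_bound := ⟨_, fun _ hφ _ ht =>
    hardyS_mean_le_const (hp₀.trans hq) hφ.measurable ht⟩

end Functional

/-! ### Test operators: (i) implies (iii) -/

section Operator

variable {α β : Type*} [MeasurableSpace α] [MeasurableSpace β] {μ : Measure α} {ν : Measure β}
  {p₀ q₀ p₁ q : ℝ} {Φ : (ℝ → ℝ≥0∞) → ℝ → ℝ≥0∞}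

theorem rearrAbs_antitone (f : α →ₘ[μ] ℝ) : Antitone (rearrAbs f) := rearr_antitone _

theorem lorentz_one (q : ℝ) (f : α →ₘ[μ] ℝ) : lorentz q 1 f =
    ∫⁻ s in Ioi (0 : ℝ), ENNReal.ofReal (s ^ (1 / q - 1)) * rearrAbs f s := by
  simp [lorentz]

/-- The value at `t` of the functional `Φ` on the averages of `|f|`. -/
def avgFunctional (Φ : (ℝ → ℝ≥0∞) → ℝ → ℝ≥0∞) (L : LengthMap μ) (f : α →ₘ[μ] ℝ) (t : ℝ) : ℝ≥0∞ :=
  Φ (L.avg fun x => ‖f x‖ₑ) t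

namespace EndpointFunctional

variable (L : LengthMap μ)

theorem avgFunctional_add_le (hΦ : EndpointFunctional p₀ q₀ p₁ q Φ) (f g : α →ₘ[μ] ℝ) {t : ℝ}
    (ht : 0 < t) :
    avgFunctional Φ L (f + g) t ≤ avgFunctional Φ L f t + avgFunctional Φ L g t :=
  (hΦ.mono _ _ (fun s _ => L.avg_enorm_add_le f g s) t ht).trans
    (hΦ.add_le _ _ (L.measurable_avg _) (L.measurable_avg _) t)

theorem avgFunctional_smul (hΦ : EndpointFunctional p₀ q₀ p₁ q Φ)
    (a : ℝ) (f : α →ₘ[μ] ℝ) (t : ℝ) :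
    avgFunctional Φ L (a • f) t = ‖a‖ₑ * avgFunctional Φ L f t := by
  rw [avgFunctional, L.avg_enorm_smul, hΦ.const_mul _ _ (L.measurable_avg _), avgFunctional]

theorem avgFunctional_le_mean [SigmaFinite μ] (hΦ : EndpointFunctional p₀ q₀ p₁ q Φ)
    (f : α →ₘ[μ] ℝ) {t : ℝ} (ht : 0 < t) :
    avgFunctional Φ L f t ≤ Φ (mean (rearrAbs f)) t :=
  hΦ.mono _ _ (fun s _ => L.avg_le_mean (RINorm.measurable_enorm f) s) t ht

theorem exists_weak_bound [SigmaFinite μ] (hΦ : EndpointFunctional p₀ q₀ p₁ q Φ) :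
    ∃ C : ℝ≥0, ∀ f : α →ₘ[μ] ℝ, ∀ t, 0 < t →
    avgFunctional Φ L f t ≤ C * ENNReal.ofReal (t ^ (-(1 / p₁))) * lorentz p₀ q₀ f := by
  obtain ⟨C, hC⟩ := hΦ.weak_bound
  exact ⟨C, fun f t ht => (hΦ.avgFunctional_le_mean L f ht).trans
    (hC _ (rearrAbs_antitone f) t ht)⟩

theorem exists_strong_bound [SigmaFinite μ] (hΦ : EndpointFunctional p₀ q₀ p₁ q Φ) :
    ∃ C : ℝ≥0, ∀ f : α →ₘ[μ] ℝ, ∀ t, 0 < t →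
    avgFunctional Φ L f t ≤ C * lorentz q 1 f := by
  obtain ⟨C, hC⟩ := hΦ.strong_bound
  exact ⟨C, fun f t ht => (hΦ.avgFunctional_le_mean L f ht).trans
    ((hC _ (rearrAbs_antitone f) t ht).trans_eq (by rw [lorentz_one]))⟩

/-- On the domain of the operators, `toReal` in `avgOperator` therefore discards nothing at positive
arguments. -/
theorem avgFunctional_lt_top [SigmaFinite μ] (hΦ : EndpointFunctional p₀ q₀ p₁ q Φ)
    {f : α →ₘ[μ] ℝ} (hf : f ∈ lorentzSum μ p₀ q₀ q) {t : ℝ} (ht : 0 < t) : avgFunctional Φ L f t < ∞ := by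
  obtain ⟨f₀, f₁, h₀, h₁, rfl⟩ := hf
  obtain ⟨C₀, hC₀⟩ := hΦ.exists_weak_bound L
  obtain ⟨C₁, hC₁⟩ := hΦ.exists_strong_bound L
  refine (hΦ.avgFunctional_add_le L f₀ f₁ ht).trans_lt (ENNReal.add_lt_top.2 ⟨?_, ?_⟩)
  · exact (hC₀ f₀ t ht).trans_lt (ENNReal.mul_lt_top
      (ENNReal.mul_lt_top ENNReal.coe_lt_top ENNReal.ofReal_lt_top) h₀)
  · exact (hC₁ f₁ t ht).trans_lt (ENNReal.mul_lt_top ENNReal.coe_lt_top h₁)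

end EndpointFunctional

/-- The operator that transports `avgFunctional` to the target space. -/
def avgOperator (hΦ : EndpointFunctional p₀ q₀ p₁ q Φ) (L : LengthMap μ) (L' : LengthMap ν)
    (f : α →ₘ[μ] ℝ) : β →ₘ[ν] ℝ :=
  AEEqFun.mk (fun y => (L'.pull (avgFunctional Φ L f) y).toReal)
    (L'.measurable_pull (hΦ.meas _)).ennreal_toReal.aestronglyMeasurable

variable (hΦ : EndpointFunctional p₀ q₀ p₁ q Φ) (L : LengthMap μ) (L' : LengthMap ν)

theorem coeFn_avgOperator (f : α →ₘ[μ] ℝ) :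
    ∀ᵐ y ∂ν, avgOperator hΦ L L' f y = (L'.pull (avgFunctional Φ L f) y).toReal :=
  AEEqFun.coeFn_mk _ _

theorem enorm_avgOperator_le (f : α →ₘ[μ] ℝ) :
    ∀ᵐ y ∂ν, ‖avgOperator hΦ L L' f y‖ₑ ≤ L'.pull (avgFunctional Φ L f) y := by
  filter_upwards [coeFn_avgOperator hΦ L L' f] with y hy
  rw [hy, Real.enorm_of_nonneg ENNReal.toReal_nonneg]
  exact ENNReal.ofReal_toReal_le

theorem enorm_avgOperator [SigmaFinite μ] {f : α →ₘ[μ] ℝ} (hf : f ∈ lorentzSum μ p₀ q₀ q) :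
    ∀ᵐ y ∂ν, ‖avgOperator hΦ L L' f y‖ₑ = L'.pull (avgFunctional Φ L f) y := by
  filter_upwards [coeFn_avgOperator hΦ L L' f, L'.ae_pos] with y hy hpos
  rw [hy, Real.enorm_of_nonneg ENNReal.toReal_nonneg, ENNReal.ofReal_toReal]
  by_cases hmem : y ∈ L'.carrier
  · simpa [LengthMap.pull, hmem] using (hΦ.avgFunctional_lt_top L hf (hpos hmem)).ne
  · simp [LengthMap.pull, hmem]

theorem sublinear_avgOperator [SigmaFinite μ] :
    Sublinear (lorentzSum μ p₀ q₀ q) (avgOperator hΦ L L') := by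
  refine ⟨fun f hf g hg => ?_, fun a f hf => ?_⟩
  · filter_upwards [coeFn_avgOperator hΦ L L' f, coeFn_avgOperator hΦ L L' g,
      coeFn_avgOperator hΦ L L' (f + g), L'.ae_pos] with y h1 h2 h3 hpos
    rw [h1, h2, h3, abs_of_nonneg ENNReal.toReal_nonneg, abs_of_nonneg ENNReal.toReal_nonneg,
      abs_of_nonneg ENNReal.toReal_nonneg, one_mul]
    by_cases hmem : y ∈ L'.carrier
    · have hf' := (hΦ.avgFunctional_lt_top L hf (hpos hmem)).ne
      have hg' := (hΦ.avgFunctional_lt_top L hg (hpos hmem)).ne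
      simp only [LengthMap.pull, hmem, indicator_of_mem, Function.comp_apply]
      rw [← ENNReal.toReal_add hf' hg']
      exact ENNReal.toReal_mono (ENNReal.add_ne_top.2 ⟨hf', hg'⟩)
        (hΦ.avgFunctional_add_le L f g (hpos hmem))
    · simp [LengthMap.pull, hmem]
  · filter_upwards [coeFn_avgOperator hΦ L L' f, coeFn_avgOperator hΦ L L' (a • f)] with y h1 h2
    rw [h1, h2, abs_of_nonneg ENNReal.toReal_nonneg, abs_of_nonneg ENNReal.toReal_nonneg]
    by_cases hmem : y ∈ L'.carrier
    · simp [LengthMap.pull, hmem, hΦ.avgFunctional_smul, ENNReal.toReal_mul]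
    · simp [LengthMap.pull, hmem]

theorem endpointBounds_avgOperator [SigmaFinite μ] (hp₁ : 0 < p₁) :
    EndpointBounds p₀ q₀ p₁ q (avgOperator hΦ L L') := by
  constructor
  · obtain ⟨C, hC⟩ := hΦ.exists_weak_bound L
    refine ⟨C, fun f _ => iSup₂_le fun t ht => ?_⟩
    have : rearrAbs (avgOperator hΦ L L' f) t ≤
        C * ENNReal.ofReal (t ^ (-(1 / p₁))) * lorentz p₀ q₀ f := by
      -- The pointwise bound `C σ'(y)^{-1/p₁} ‖f‖` decreases in `σ'(y)`, so it exceeds its value at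
      -- `t` only where `σ'(y) < t`, a set of measure at most `t`.
      refine rearr_le_iff.2 (le_trans (measure_mono_ae ?_) (L'.measure_lt_le t))
      filter_upwards [enorm_avgOperator_le hΦ L L' f, L'.ae_pos] with y hy hpos hlt
      have hlt := lt_of_lt_of_le hlt hy
      by_cases hmem : y ∈ L'.carrier
      · refine ⟨hmem, ?_⟩
        by_contra hge
        have hge : t ≤ L'.toFun y := not_lt.1 hge
        simp only [LengthMap.pull, hmem, indicator_of_mem, Function.comp_apply] at hlt
        refine absurd hlt (not_lt.2 ((hC f _ (hpos hmem)).trans ?_))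
        refine mul_le_mul_left (mul_le_mul_right (ENNReal.ofReal_le_ofReal
          (Real.rpow_le_rpow_of_nonpos ht hge ?_)) _) _
        rw [neg_nonpos]
        positivity
      · simp [LengthMap.pull, hmem] at hlt
    refine (mul_le_mul_right this _).trans_eq ?_
    rw [← mul_assoc, mul_left_comm, ofReal_rpow_mul_rpow ht]
    simp
  · obtain ⟨C, hC⟩ := hΦ.exists_strong_bound L
    refine ⟨C, fun f _ => ?_⟩
    rw [supNorm, eLpNorm_exponent_top]
    refine essSup_le_of_ae_le _ ?_
    filter_upwards [enorm_avgOperator_le hΦ L L' f, L'.ae_pos] with y hy hpos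
    refine hy.trans ?_
    by_cases hmem : y ∈ L'.carrier
    · simpa [LengthMap.pull, hmem] using hC f _ (hpos hmem)
    · simp [LengthMap.pull, hmem]

theorem measurable_angle (p : ℝ) (f : β →ₘ[ν] ℝ) :
    Measurable fun t : ℝ => ENNReal.ofReal (t ^ (-(1 / p))) *
      ⨆ (s : ℝ) (_ : 0 < s ∧ s ≤ t), ENNReal.ofReal (s ^ (1 / p)) * rearrAbs f s := by
  have h : Monotone fun t : ℝ =>
      ⨆ (s : ℝ) (_ : 0 < s ∧ s ≤ t), ENNReal.ofReal (s ^ (1 / p)) * rearrAbs f s :=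
    fun t t' htt' => iSup₂_le fun s hs => le_iSup₂_of_le s ⟨hs.1, hs.2.trans htt'⟩ le_rfl
  exact (measurable_ofReal_rpow _).mul h.measurable

theorem RINorm.norm_le_angleNorm (ρ : RINorm ν) (L' : LengthMap ν) (p : ℝ) (f : β →ₘ[ν] ℝ) :
    ρ.norm f ≤ ρ.angleNorm p f := by
  rw [← ρ.repr_rearrAbs]
  refine ρ.repr_mono L' (measurable_rearr _) (measurable_angle p f) fun t ht => ?_
  calc rearrAbs f t = ENNReal.ofReal (t ^ (-(1 / p))) *
        (ENNReal.ofReal (t ^ (1 / p)) * rearrAbs f t) := by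
        rw [← mul_assoc, ofReal_rpow_mul_rpow ht]; simp
    _ ≤ _ := mul_le_mul_right (le_iSup₂ (f := fun (s : ℝ) (_ : 0 < s ∧ s ≤ t) =>
        ENNReal.ofReal (s ^ (1 / p)) * rearrAbs f s) t ⟨ht, le_rfl⟩) _

/-- Test the operator on a real function `G` whose modulus is `f^* ∘ σ`: it has the norm of `f`, and
its averages dominate `f^*`. The inclusion of `X` in the Lorentz sum keeps the operator finite at
`G`. -/
theorem boundedRepr_of_bounded_avgOperator [SigmaFinite μ] (X : RINorm μ) (Y : RINorm ν)
    (hX : ∀ f : α →ₘ[μ] ℝ, X.norm f < ∞ → f ∈ lorentzSum μ p₀ q₀ q)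
    (hT : BoundedFrom X.norm (Y.angleNorm p₁) (avgOperator hΦ L L')) :
    BoundedRepr X Y fun f => Φ (rearr (halfLine μ) f) := by
  obtain ⟨C, hC⟩ := hT
  refine ⟨C, fun f hf hfX => ?_⟩
  set φ := rearr (halfLine μ) f with hφ
  have hφm : Measurable φ := measurable_rearr f
  have hX1 : X.repr f = X.toFun (L.pull φ) :=
    X.repr_eq_of_rearr_eq (L.measurable_pull hφm) fun t _ => by
      rw [L.rearr_pull hφm, hφ, rearr_rearr_halfLine]
  obtain ⟨G, hG⟩ := X.exists_enorm_eq (L.measurable_pull hφm) (hX1 ▸ hfX)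
  have hGX : X.norm G = X.repr f := by
    rw [hX1]
    exact X.congr_ae (RINorm.measurable_enorm G) (L.measurable_pull hφm) hG
  have hGD := hX G (hGX ▸ hfX)
  calc Y.repr (Φ φ) ≤ Y.repr (avgFunctional Φ L G) := by
        refine Y.repr_mono L' (hΦ.meas _) (hΦ.meas _) (hΦ.mono _ _ fun s hs => ?_)
        rw [L.avg_congr hG]
        exact L.rearr_le_avg_pull f hs
    _ = Y.norm (avgOperator hΦ L L' G) := by
        rw [Y.repr_eq_pull L' (h := avgFunctional Φ L G) (hΦ.meas _)]
        exact Y.congr_ae (L'.measurable_pull (hΦ.meas _)) (RINorm.measurable_enorm _)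
          ((enorm_avgOperator hΦ L L' hGD).mono fun _ h => h.symm)
    _ ≤ Y.angleNorm p₁ (avgOperator hΦ L L' G) := Y.norm_le_angleNorm L' p₁ _
    _ ≤ C * X.norm G := hC G (hGX ▸ hfX)
    _ = C * X.repr f := by rw [hGX]

end Operator

/-! ### Truncation and pointwise interpolation: (iii) implies (ii) -/

section Interpolation

variable {α β : Type*} [MeasurableSpace α] [MeasurableSpace β] {μ : Measure α} {ν : Measure β}
  {p₀ q₀ p₁ q : ℝ}

/-- The truncation of `f` to values in `[-l, l]`. -/
def truncate (l : ℝ) (f : α →ₘ[μ] ℝ) : α →ₘ[μ] ℝ :=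
  AEEqFun.comp (fun x => max (-l) (min l x)) (by fun_prop) f

theorem coeFn_truncate (l : ℝ) (f : α →ₘ[μ] ℝ) :
    ∀ᵐ x ∂μ, truncate l f x = max (-l) (min l (f x)) :=
  AEEqFun.coeFn_comp _ _ f

theorem enorm_le_enorm {a b : ℝ} (h : |a| ≤ |b|) : ‖a‖ₑ ≤ ‖b‖ₑ := by
  rw [Real.enorm_eq_ofReal_abs, Real.enorm_eq_ofReal_abs]
  exact ENNReal.ofReal_le_ofReal h

theorem rearrAbs_truncate_le {l : ℝ} (hl : 0 ≤ l) (f : α →ₘ[μ] ℝ) (s : ℝ) :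
    rearrAbs (truncate l f) s ≤ rearrAbs f s := by
  refine rearr_mono_ae ?_ s
  filter_upwards [coeFn_truncate l f] with x hx
  rw [hx]
  refine enorm_le_enorm ?_
  rcases le_total 0 (f x) with h | h
  · rw [max_eq_right (by linarith [le_min hl h]), abs_of_nonneg (le_min hl h), abs_of_nonneg h]
    exact min_le_right _ _
  · rw [min_eq_right (h.trans hl), abs_of_nonpos (max_le (by linarith) h), abs_of_nonpos h]
    linarith [le_max_right (-l) (f x)]

theorem rearrAbs_truncate_le_const {l : ℝ} (hl : 0 ≤ l) (f : α →ₘ[μ] ℝ) (s : ℝ) :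
    rearrAbs (truncate l f) s ≤ ENNReal.ofReal l := by
  refine rearr_le_iff.2 ?_
  refine le_of_eq_of_le (measure_eq_zero_iff_ae_notMem.2 ?_) zero_le
  filter_upwards [coeFn_truncate l f] with x hx
  simp only [not_lt]
  rw [hx, Real.enorm_eq_ofReal_abs]
  refine ENNReal.ofReal_le_ofReal (abs_le.2 ⟨le_max_left _ _,
    max_le (by linarith) (min_le_left _ _)⟩)

theorem abs_sub_truncate {l : ℝ} (hl : 0 ≤ l) (a : ℝ) :
    |a - max (-l) (min l a)| = max 0 (|a| - l) := by
  rcases le_total 0 a with h | h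
  · rw [abs_of_nonneg h, max_eq_right (by linarith [le_min hl h])]
    rcases le_total l a with h' | h'
    · rw [min_eq_left h', abs_of_nonneg (by linarith), max_eq_right (by linarith)]
    · rw [min_eq_right h', sub_self, abs_zero, max_eq_left (by linarith)]
  · rw [abs_of_nonpos h, min_eq_right (h.trans hl)]
    rcases le_total (-l) a with h' | h'
    · rw [max_eq_right h', sub_self, abs_zero, max_eq_left (by linarith)]
    · rw [max_eq_left h', abs_of_nonpos (by linarith), max_eq_right (by linarith)]
      ring

theorem enorm_sub_truncate {l : ℝ} (hl : 0 ≤ l) (f : α →ₘ[μ] ℝ) :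
    ∀ᵐ x ∂μ, ‖(f - truncate l f) x‖ₑ = ENNReal.ofReal (max 0 (|f x| - l)) := by
  filter_upwards [coeFn_truncate l f, AEEqFun.coeFn_sub f (truncate l f)] with x hx hx'
  rw [hx', Pi.sub_apply, hx, Real.enorm_eq_ofReal_abs, abs_sub_truncate hl]

theorem rearrAbs_sub_truncate_le {l : ℝ} (hl : 0 ≤ l) (f : α →ₘ[μ] ℝ) (s : ℝ) :
    rearrAbs (f - truncate l f) s ≤ rearrAbs f s := by
  refine rearr_mono_ae ?_ s
  filter_upwards [enorm_sub_truncate hl f] with x hx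
  rw [hx, Real.enorm_eq_ofReal_abs]
  exact ENNReal.ofReal_le_ofReal (max_le (abs_nonneg _) (by linarith))

theorem rearrAbs_sub_truncate_eq_zero {l : ℝ} (hl : 0 ≤ l) (f : α →ₘ[μ] ℝ) {s : ℝ}
    (h : rearrAbs f s ≤ ENNReal.ofReal l) : rearrAbs (f - truncate l f) s = 0 := by
  refine nonpos_iff_eq_zero.1 (rearr_le_iff.2 (le_trans (measure_mono_ae ?_) (rearr_le_iff.1 h)))
  filter_upwards [enorm_sub_truncate hl f] with x hx hlt
  have hlt : (0 : ℝ≥0∞) < ‖(f - truncate l f) x‖ₑ := hlt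
  rw [hx, ENNReal.ofReal_pos, lt_max_iff] at hlt
  have : l < |f x| := by
    rcases hlt with h | h
    · exact absurd h (lt_irrefl _)
    · linarith
  show ENNReal.ofReal l < ‖f x‖ₑ
  rw [Real.enorm_eq_ofReal_abs]
  exact (ENNReal.ofReal_lt_ofReal_iff_of_nonneg hl).2 this

theorem lorentz_sub_truncate_le (hq₀ : 0 < q₀) {l u : ℝ} (hl : 0 ≤ l) (f : α →ₘ[μ] ℝ)
    (h : rearrAbs f u ≤ ENNReal.ofReal l) :
    lorentz p₀ q₀ (f - truncate l f) ≤
      (∫⁻ s in Ioo 0 u, ENNReal.ofReal (s ^ (q₀ / p₀ - 1)) * rearrAbs f s ^ q₀) ^ (1 / q₀) := by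
  refine ENNReal.rpow_le_rpow ?_ (by positivity)
  have h1 : ∀ s, s ∈ Ioi (0 : ℝ) →
      ENNReal.ofReal (s ^ (q₀ / p₀ - 1)) * rearrAbs (f - truncate l f) s ^ q₀ ≤
      (Iio u).indicator (fun s => ENNReal.ofReal (s ^ (q₀ / p₀ - 1)) * rearrAbs f s ^ q₀) s := by
    intro s _
    by_cases hs : s < u
    · rw [indicator_of_mem (show s ∈ Iio u from hs)]
      gcongr
      exact rearrAbs_sub_truncate_le hl f s
    · rw [rearrAbs_sub_truncate_eq_zero hl f ((rearrAbs_antitone f (not_lt.1 hs)).trans h),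
        ENNReal.zero_rpow_of_pos hq₀, mul_zero]
      exact zero_le
  refine (setLIntegral_mono' measurableSet_Ioi h1).trans_eq ?_
  rw [lintegral_indicator measurableSet_Iio, Measure.restrict_restrict measurableSet_Iio,
    Iio_inter_Ioi]

theorem lorentz_truncate_le (hq : 0 < q) {l u : ℝ} (hl : 0 ≤ l) (hu : 0 < u) (f : α →ₘ[μ] ℝ) :
    lorentz q 1 (truncate l f) ≤ ENNReal.ofReal (u ^ (1 / q) / (1 / q)) * ENNReal.ofReal l +
      ∫⁻ s in Ioi u, ENNReal.ofReal (s ^ (1 / q - 1)) * rearrAbs f s := by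
  rw [lorentz_one, ← Ioc_union_Ioi_eq_Ioi hu.le]
  refine (lintegral_union_le _ _ _).trans (add_le_add ?_ ?_)
  · rw [← restrict_Ioo_eq_restrict_Ioc, ← lintegral_Ioo_rpow (by positivity) hu.le,
      ← lintegral_mul_const _ (by fun_prop)]
    exact lintegral_mono fun s => mul_le_mul_right (rearrAbs_truncate_le_const hl f s) _
  · exact lintegral_mono fun s => mul_le_mul_right (rearrAbs_truncate_le hl f s) _

theorem lorentz_zero (p : ℝ) {q : ℝ} (hq : 0 < q) : lorentz p q (0 : α →ₘ[μ] ℝ) = 0 := by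
  have h : ∀ t, rearrAbs (0 : α →ₘ[μ] ℝ) t = 0 := by
    intro t
    have h0 : (fun x => ‖(0 : α →ₘ[μ] ℝ) x‖ₑ) =ᵐ[μ] fun _ => 0 := by
      filter_upwards [AEEqFun.coeFn_zero (α := α) (β := ℝ) (μ := μ)] with x hx
      rw [hx, Pi.zero_apply, enorm_zero]
    rw [rearrAbs, rearr_congr_ae h0]
    exact nonpos_iff_eq_zero.1 (rearr_le_iff.2 (by simp))
  simp [lorentz, h, ENNReal.zero_rpow_of_pos hq, hq]

theorem mem_lorentzSum_left {f : α →ₘ[μ] ℝ} (hf : lorentz p₀ q₀ f < ∞) :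
    f ∈ lorentzSum μ p₀ q₀ q :=
  ⟨f, 0, hf, by rw [lorentz_zero q one_pos]; exact ENNReal.zero_lt_top, (add_zero f).symm⟩

theorem mem_lorentzSum_right (hq₀ : 0 < q₀) {f : α →ₘ[μ] ℝ} (hf : lorentz q 1 f < ∞) :
    f ∈ lorentzSum μ p₀ q₀ q :=
  ⟨0, f, by rw [lorentz_zero p₀ hq₀]; exact ENNReal.zero_lt_top, hf, (zero_add f).symm⟩

/-- Adding a bounded function only shifts levels, so the argument `s` need not be split between the
two terms. -/
theorem rearrAbs_le_of_abs_le {k : ℝ≥0} {h h₀ h₁ : β →ₘ[ν] ℝ} {N : ℝ≥0∞}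
    (hk : ∀ᵐ y ∂ν, |h y| ≤ k * (|h₀ y| + |h₁ y|)) (hN : supNorm h₁ ≤ N) (s : ℝ) :
    rearrAbs h s ≤ k * rearrAbs h₀ s + k * N := by
  refine rearr_le_iff.2 (le_trans (measure_mono_ae ?_)
    (rearr_le_iff.1 (le_refl (rearrAbs h₀ s))))
  have hN' : ∀ᵐ y ∂ν, ‖h₁ y‖ₑ ≤ N := by
    rw [supNorm, eLpNorm_exponent_top] at hN
    exact (enorm_ae_le_eLpNormEssSup h₁ ν).mono fun y hy => hy.trans hN
  filter_upwards [hk, hN'] with y hy hy' hlt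
  have hlt : (k : ℝ≥0∞) * rearrAbs h₀ s + k * N < ‖h y‖ₑ := hlt
  show rearrAbs h₀ s < ‖h₀ y‖ₑ
  by_contra hle
  refine absurd hlt (not_lt.2 ?_)
  calc ‖h y‖ₑ ≤ k * (‖h₀ y‖ₑ + ‖h₁ y‖ₑ) := by
        simp only [Real.enorm_eq_ofReal_abs]
        rw [← ENNReal.ofReal_add (abs_nonneg _) (abs_nonneg _), ← ENNReal.ofReal_coe_nnreal,
          ← ENNReal.ofReal_mul k.coe_nonneg]
        exact ENNReal.ofReal_le_ofReal hy
    _ ≤ k * (rearrAbs h₀ s + N) := by gcongr; exact not_lt.1 hle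
    _ = _ := mul_add _ _ _

theorem exists_angle_le (hp₀ : 1 < p₀) (hq : p₀ < q) (hp₁ : 1 < p₁) (hq₀ : 1 ≤ q₀)
    {T : (α →ₘ[μ] ℝ) → (β →ₘ[ν] ℝ)} (hT : Quasilinear (lorentzSum μ p₀ q₀ q) T)
    (hTb : EndpointBounds p₀ q₀ p₁ q T) :
    ∃ K : ℝ≥0, ∀ (f : α →ₘ[μ] ℝ) (t : ℝ), 0 < t →
      ENNReal.ofReal (t ^ (-(1 / p₁))) *
        (⨆ (s : ℝ) (_ : 0 < s ∧ s ≤ t), ENNReal.ofReal (s ^ (1 / p₁)) * rearrAbs (T f) s) ≤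
      K * (hardyR p₀ q₀ p₁ q (rearrAbs f) t + hardyS p₀ p₁ q (rearrAbs f) t) := by
  obtain ⟨k, hk1, hTk, -⟩ := hT
  obtain ⟨⟨C₀, hC₀⟩, ⟨C₁, hC₁⟩⟩ := hTb
  lift k to ℝ≥0 using by linarith
  -- The factor `q` comes from integrating `s^{1/q-1}` over `(0, u)`, the other from
  -- `rpow_mul_antitone_le`.
  set c : ℝ≥0 := q.toNNReal * ((q₀ / p₀) ^ (1 / q₀)).toNNReal with hc
  -- The summand `1` keeps the constant nonzero, so that the right side is infinite when `A + B =
  -- ∞`.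
  refine ⟨k * C₀ + k * (C₁ * c) + k * C₁ + 1, fun f t ht => ?_⟩
  set φ := rearrAbs f with hφ
  set A := hardyR p₀ q₀ p₁ q φ t with hA
  set B := hardyS p₀ p₁ q φ t with hB
  have hq' : 0 < q := by linarith
  have hp₀' : 0 < p₀ := by linarith
  have hp₁' : 0 < p₁ := by linarith
  have hq₀' : 0 < q₀ := by linarith
  by_cases hAB : A + B = ∞
  · rw [hAB, ENNReal.mul_top (by simp)]
    exact le_top
  obtain ⟨hAfin, hBfin⟩ := ENNReal.add_ne_top.1 hAB
  set u := t ^ slope p₀ p₁ q with hu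
  have hupos : 0 < u := Real.rpow_pos_of_pos ht _
  set I := (∫⁻ s in Ioo 0 u, ENNReal.ofReal (s ^ (q₀ / p₀ - 1)) * φ s ^ q₀) ^ (1 / q₀) with hI
  have hAI : A = ENNReal.ofReal (t ^ (-(1 / p₁))) * I := rfl
  have hIA : I = ENNReal.ofReal (t ^ (1 / p₁)) * A := by
    rw [hAI, ← mul_assoc, ofReal_rpow_mul_rpow ht]; simp
  have hIfin : I < ∞ := by
    rw [hIA]; exact ENNReal.mul_lt_top ENNReal.ofReal_lt_top hAfin.lt_top
  have hφu : ENNReal.ofReal (u ^ (1 / p₀)) * φ u ≤ ENNReal.ofReal ((q₀ / p₀) ^ (1 / q₀)) * I :=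
    rpow_mul_antitone_le (rearrAbs_antitone f) hp₀' hq₀' hupos
  have hφfin : φ u ≠ ∞ := by
    intro h
    rw [h, ENNReal.mul_top (by rw [Ne, ENNReal.ofReal_eq_zero, not_le]; positivity)] at hφu
    exact absurd hφu (not_le.2 (ENNReal.mul_lt_top ENNReal.ofReal_lt_top hIfin))
  -- The truncation height is `f^*(t^r)`, finite because `I` is.
  set l := (φ u).toReal with hl
  have hl0 : 0 ≤ l := ENNReal.toReal_nonneg
  have hlφ : ENNReal.ofReal l = φ u := ENNReal.ofReal_toReal hφfin
  have hf₀ : lorentz p₀ q₀ (f - truncate l f) ≤ I := lorentz_sub_truncate_le hq₀' hl0 f hlφ.ge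
  have hf₁ : lorentz q 1 (truncate l f) ≤ c * A + B := by
    refine (lorentz_truncate_le hq' hl0 hupos f).trans (add_le_add_left ?_ _)
    rw [hlφ, div_eq_mul_one_div, one_div_one_div, mul_comm (u ^ (1 / q)),
      ENNReal.ofReal_mul hq'.le]
    -- By `slope_mul`, `u^{1/q} φ u = t^{-1/p₁} u^{1/p₀} φ u`, which is at most a constant times
    -- `t^{-1/p₁} I = A`.
    have hexp : 1 / q = -(1 / p₀ - 1 / q) + 1 / p₀ := by ring
    have hut : u ^ (-(1 / p₀ - 1 / q)) = t ^ (-(1 / p₁)) := by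
      rw [hu, ← Real.rpow_mul ht.le, mul_neg, slope_mul hp₀ hq hp₁]
    rw [hexp, ← ofReal_rpow_mul_rpow hupos, hut, mul_assoc, mul_assoc]
    refine (mul_le_mul_right (mul_le_mul_right hφu _) _).trans_eq ?_
    rw [hAI, hc]
    simp only [ENNReal.coe_mul, ENNReal.ofReal]
    ring
  have hf₀fin := hf₀.trans_lt hIfin
  have hf₁fin : lorentz q 1 (truncate l f) < ∞ := hf₁.trans_lt
    (ENNReal.add_lt_top.2 ⟨ENNReal.mul_lt_top ENNReal.coe_lt_top hAfin.lt_top, hBfin.lt_top⟩)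
  have hTf := hTk _ (mem_lorentzSum_left hf₀fin) _ (mem_lorentzSum_right hq₀' hf₁fin)
  rw [sub_add_cancel] at hTf
  have hTf₁ : supNorm (T (truncate l f)) ≤ C₁ * (c * A + B) :=
    (hC₁ _ hf₁fin).trans (mul_le_mul_right hf₁ _)
  have hTf₀ : ∀ s, 0 < s →
      ENNReal.ofReal (s ^ (1 / p₁)) * rearrAbs (T (f - truncate l f)) s ≤ C₀ * I := fun s hs =>
    (le_iSup₂ (f := fun (s : ℝ) (_ : 0 < s) =>
      ENNReal.ofReal (s ^ (1 / p₁)) * rearrAbs (T (f - truncate l f)) s) s hs).trans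
      ((hC₀ _ hf₀fin).trans (mul_le_mul_right hf₀ _))
  have hsup : (⨆ (s : ℝ) (_ : 0 < s ∧ s ≤ t), ENNReal.ofReal (s ^ (1 / p₁)) * rearrAbs (T f) s) ≤
      k * (C₀ * I) + ENNReal.ofReal (t ^ (1 / p₁)) * (k * (C₁ * (c * A + B))) := by
    refine iSup₂_le fun s hs => ?_
    calc ENNReal.ofReal (s ^ (1 / p₁)) * rearrAbs (T f) s
        ≤ ENNReal.ofReal (s ^ (1 / p₁)) * (k * rearrAbs (T (f - truncate l f)) s +
            k * (C₁ * (c * A + B))) := mul_le_mul_right (rearrAbs_le_of_abs_le hTf hTf₁ s) _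
      _ = k * (ENNReal.ofReal (s ^ (1 / p₁)) * rearrAbs (T (f - truncate l f)) s) +
            ENNReal.ofReal (s ^ (1 / p₁)) * (k * (C₁ * (c * A + B))) := by ring
      _ ≤ _ := by
        refine add_le_add (mul_le_mul_right (hTf₀ s hs.1) _) (mul_le_mul_left
          (ENNReal.ofReal_le_ofReal (Real.rpow_le_rpow hs.1.le hs.2 (by positivity))) _)
  refine (mul_le_mul_right hsup _).trans ?_
  calc ENNReal.ofReal (t ^ (-(1 / p₁))) *
        (k * (C₀ * I) + ENNReal.ofReal (t ^ (1 / p₁)) * (k * (C₁ * (c * A + B))))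
      = k * C₀ * (ENNReal.ofReal (t ^ (-(1 / p₁))) * I) +
        ENNReal.ofReal (t ^ (-(1 / p₁))) * ENNReal.ofReal (t ^ (1 / p₁)) *
          (k * (C₁ * (c * A + B))) := by ring
    _ = (k * C₀ + k * (C₁ * c)) * A + k * C₁ * B := by
        rw [ofReal_rpow_mul_rpow ht, ← hAI, neg_add_cancel, Real.rpow_zero, ENNReal.ofReal_one]
        ring
    _ ≤ (k * C₀ + k * (C₁ * c) + k * C₁ + 1) * A + (k * C₀ + k * (C₁ * c) + k * C₁ + 1) * B := by
        refine add_le_add (mul_le_mul_left ?_ _) (mul_le_mul_left ?_ _)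
        · rw [add_assoc]; exact le_self_add
        · rw [add_right_comm]; exact le_add_self
    _ = _ := by push_cast; ring

theorem bounded_of_boundedRepr (L' : LengthMap ν) (hp₀ : 1 < p₀) (hq : p₀ < q) (hp₁ : 1 < p₁)
    (hq₀ : 1 ≤ q₀) (X : RINorm μ) (Y : RINorm ν)
    (hR : BoundedRepr X Y (calderonR (halfLine μ) p₀ q₀ p₁ q))
    (hS : BoundedRepr X Y (calderonS (halfLine μ) p₀ p₁ q))
    {T : (α →ₘ[μ] ℝ) → (β →ₘ[ν] ℝ)} (hT : Quasilinear (lorentzSum μ p₀ q₀ q) T)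
    (hTb : EndpointBounds p₀ q₀ p₁ q T) : BoundedFrom X.norm (Y.angleNorm p₁) T := by
  obtain ⟨K, hK⟩ := exists_angle_le hp₀ hq hp₁ hq₀ hT hTb
  obtain ⟨CR, hCR⟩ := hR
  obtain ⟨CS, hCS⟩ := hS
  refine ⟨K * (CR + CS), fun f hf => ?_⟩
  have hrr : rearr (halfLine μ) (rearrAbs f) = rearrAbs f := funext fun t => rearr_rearr _ t
  have hfX : X.repr (rearrAbs f) < ∞ := by rwa [X.repr_rearrAbs]
  have hR' := hCR (rearrAbs f) (measurable_rearr _) hfX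
  have hS' := hCS (rearrAbs f) (measurable_rearr _) hfX
  have eR : calderonR (halfLine μ) p₀ q₀ p₁ q (rearrAbs f) = hardyR p₀ q₀ p₁ q (rearrAbs f) := by
    conv_rhs => rw [← hrr]
    rfl
  have eS : calderonS (halfLine μ) p₀ p₁ q (rearrAbs f) = hardyS p₀ p₁ q (rearrAbs f) := by
    conv_rhs => rw [← hrr]
    rfl
  rw [eR, X.repr_rearrAbs] at hR'
  rw [eS, X.repr_rearrAbs] at hS'
  have hm : Measurable fun t => hardyR p₀ q₀ p₁ q (rearrAbs f) t + hardyS p₀ p₁ q (rearrAbs f) t :=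
    measurable_hardyR.add measurable_hardyS
  calc Y.angleNorm p₁ (T f)
      ≤ Y.repr fun t => K * (hardyR p₀ q₀ p₁ q (rearrAbs f) t + hardyS p₀ p₁ q (rearrAbs f) t) :=
        Y.repr_mono L' (measurable_angle p₁ (T f)) (hm.const_mul _) (hK f)
    _ = K * Y.repr fun t => hardyR p₀ q₀ p₁ q (rearrAbs f) t + hardyS p₀ p₁ q (rearrAbs f) t :=
        Y.repr_const_mul L' K hm
    _ ≤ K * (CR * X.norm f + CS * X.norm f) := mul_le_mul_right
        ((Y.repr_add_le L' measurable_hardyR measurable_hardyS).trans (add_le_add hR' hS')) _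
    _ = _ := by push_cast; ring

end Interpolation

end RI

end

theorem mainTheorem2 {α β : Type*} [MeasurableSpace α] [MeasurableSpace β]
    (μ : MeasureTheory.Measure α) (ν : MeasureTheory.Measure β)
    [MeasureTheory.SigmaFinite μ] [MeasureTheory.SigmaFinite ν]
    (hμ : RI.Nonatomic μ) (hν : RI.Nonatomic ν)
    (p₀ q₀ p₁ q : ℝ) (hp₀ : 1 < p₀) (hq : p₀ < q) (hp₁ : 1 < p₁) (hq₀ : 1 ≤ q₀)
    (X : RI.RINorm μ) (Y : RI.RINorm ν)
    (hX : ∀ f : α →ₘ[μ] ℝ, X.norm f < ⊤ → f ∈ RI.lorentzSum μ p₀ q₀ q) :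
    List.TFAE [
      ∀ T : (α →ₘ[μ] ℝ) → (β →ₘ[ν] ℝ), RI.Sublinear (RI.lorentzSum μ p₀ q₀ q) T →
        RI.EndpointBounds p₀ q₀ p₁ q T → RI.BoundedFrom X.norm (Y.angleNorm p₁) T,
      ∀ T : (α →ₘ[μ] ℝ) → (β →ₘ[ν] ℝ), RI.Quasilinear (RI.lorentzSum μ p₀ q₀ q) T →
        RI.EndpointBounds p₀ q₀ p₁ q T → RI.BoundedFrom X.norm (Y.angleNorm p₁) T,
      RI.BoundedRepr X Y (RI.calderonR (RI.halfLine μ) p₀ q₀ p₁ q) ∧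
        RI.BoundedRepr X Y (RI.calderonS (RI.halfLine μ) p₀ p₁ q)] := by
  obtain ⟨L⟩ := RI.exists_lengthMap hμ
  obtain ⟨L'⟩ := RI.exists_lengthMap hν
  have hp₁' : 0 < p₁ := by linarith
  tfae_have 1 → 3 := fun h =>
    have hR := RI.endpointFunctional_hardyR hp₀ hq hp₁ hq₀
    have hS := RI.endpointFunctional_hardyS hp₀ hq hp₁ hq₀
    -- `calderonR` and `calderonS` are by definition `hardyR` and `hardyS` applied to the
    -- rearrangement.
    ⟨RI.boundedRepr_of_bounded_avgOperator hR L L' X Y hX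
      (h _ (RI.sublinear_avgOperator hR L L') (RI.endpointBounds_avgOperator hR L L' hp₁')),
    RI.boundedRepr_of_bounded_avgOperator hS L L' X Y hX
      (h _ (RI.sublinear_avgOperator hS L L') (RI.endpointBounds_avgOperator hS L L' hp₁'))⟩
  tfae_have 3 → 2 := fun h _ hT hTb =>
    RI.bounded_of_boundedRepr L' hp₀ hq hp₁ hq₀ X Y h.1 h.2 hT hTb
  tfae_have 2 → 1 := fun h T hT hTb => h T ⟨1, le_rfl, hT⟩ hTb
  tfae_finish
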